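/- Let $G$ be a locally compact, second countable, Hausdorff topological group. For a compact set $K\subseteq G$ and $\varepsilon>0$, the pair $(K,\varepsilon)$ is a *Kazhdan pair* of $G$ if, for every (strongly) continuous unitary representation $\pi$ of $G$ on a complex Hilbert space $\mathcal H$ without nonzero invariant vectors, the only $v\in\mathcal H$ with $\|\pi(g)v-v\|\le\varepsilon\|v\|$ for all $g\in K$ is $v=0$. In this case $\varepsilon$ is called a *Kazhdan constant* of $K$. The set $K$ is a *Kazhdan set* of $G$ if $(K,\varepsilon)$ is a Kazhdan pair of $G$ for some $\varepsilon>0$. An *ergodic action* $\rho\colon G\curvearrowright(X,\nu)$ is an action of $G$ on a probability space by measurable, measure-preserving maps such that the induced unitary representation $(g\cdot f)(x)=f(g^{-1}x)$ of $G$ on $L^2(X,\nu)$ is continuous, and such that every measurable $A\subseteq X$ with $\nu(gA\,\triangle\,A)=0$ for all $g\in G$ satisfies $\nu(A)\in\{0,1\}$. An action on $(X,\nu)$ of a group $\Gamma$ with finite symmetric generating set $S\ni 1$ is *$\alpha$-expanding* if $\nu(S\cdot A)\ge(1+\alpha)\,\nu(A)$ for every measurable $A\subseteq X$ with $\nu(A)<\infty$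 and $\nu(A)\le\nu(X)/2$, where $S\cdot A=\bigcup_{s\in S}s\cdot A$. It is *expanding in measure* if it is $\alpha$-expanding for some $\alpha>0$. **Theorem.** Let $S\subset G$ be a finite symmetric set containing the identity, and let $\Gamma=\langle S\rangle\subseteq G$ be the subgroup generated by $S$, with generating set $S$. Then $S$ is a Kazhdan set of $G$ if and only if, for every ergodic action $\rho\colon G\curvearrowright(X,\nu)$, the restriction of $\rho$ to $\Gamma$ is expanding in measure. Moreover, for every $\varepsilon>0$ there is $\alpha>0$, depending only on $\varepsilon$ (and not on $G$, $S$ or the action), such that whenever $(S,\varepsilon)$ is a Kazhdan pair of $G$ with $S$ as above, the restriction to $\Gamma$ of every ergodic action of $G$ is $\alpha$-expanding. -/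

import Mathlib

open MeasureTheory
open scoped Pointwise ENNReal

universe u v

/-- A (strongly) continuous unitary representation of the topological group `G` on the complex
Hilbert space `H`. -/
structure ContUnitaryRep (G : Type u) [Group G] [TopologicalSpace G]
    (H : Type v) [NormedAddCommGroup H] [InnerProductSpace ℂ H] where
  /-- The underlying homomorphism into the group of unitary operators of `H`. -/
  toHom : G →* (H ≃ₗᵢ[ℂ] H)
  /-- Every orbit map is continuous. -/
  continuous_orbit : ∀ x : H, Continuous fun g : G => toHom g x

namespace ContUnitaryRep

variable {G : Type u} [Group G] [TopologicalSpace G]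
  {H : Type v} [NormedAddCommGroup H] [InnerProductSpace ℂ H]

/-- `x` is fixed by the whole group. -/
def IsInvariantVector (π : ContUnitaryRep G H) (x : H) : Prop :=
  ∀ g : G, π.toHom g x = x

/-- `x` is a `(K, ε)`-invariant vector: `‖π(g) x - x‖ ≤ ε ‖x‖` for every `g ∈ K`. -/
def IsAlmostInvariantVector (π : ContUnitaryRep G H) (K : Set G) (ε : ℝ) (x : H) : Prop :=
  ∀ g ∈ K, ‖π.toHom g x - x‖ ≤ ε * ‖x‖

/-- The representation has no invariant vector other than `0`. -/
def HasNoInvariantVectors (π : ContUnitaryRep G H) : Prop :=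
  ∀ x : H, π.IsInvariantVector x → x = 0

/-- `(K, ε)` is a Kazhdan pair for the single representation `π`: there is no nonzero
`(K, ε)`-invariant vector. -/
def IsKazhdanPairFor (π : ContUnitaryRep G H) (K : Set G) (ε : ℝ) : Prop :=
  ∀ x : H, π.IsAlmostInvariantVector K ε x → x = 0

end ContUnitaryRep

/-- `(K, ε)`, with `K` compact and `ε > 0`, is a Kazhdan pair of the group `G`: it is a Kazhdan pair
for the family of all continuous unitary representations of `G` on complex Hilbert spaces without
nonzero invariant vectors. -/
def IsKazhdanPair {G : Type u} [Group G] [TopologicalSpace G] (K : Set G) (ε : ℝ) : Prop :=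
  IsCompact K ∧ 0 < ε ∧
    ∀ (H : Type v) [NormedAddCommGroup H] [InnerProductSpace ℂ H] [CompleteSpace H]
      (π : ContUnitaryRep G H), π.HasNoInvariantVectors → π.IsKazhdanPairFor K ε

/-- `K` is a Kazhdan set of `G`: `(K, ε)` is a Kazhdan pair of `G` for some `ε`. -/
def IsKazhdanSet {G : Type u} [Group G] [TopologicalSpace G] (K : Set G) : Prop :=
  ∃ ε : ℝ, IsKazhdanPair.{u, v} K ε

/-- The action of a group `Γ` with distinguished generating set `T` on the measure space `(X, ν)` is
`α`-expanding: `ν (T • A) ≥ (1 + α) ν A` for each measurable `A` of finite measure with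
`ν A ≤ ν X / 2`, where `T • A` is the union of the sets `s • A` for `s ∈ T`. -/
def IsExpandingWith {Γ : Type u} [Group Γ] (T : Set Γ)
    {X : Type v} [MeasurableSpace X] [MulAction Γ X] (ν : Measure X) (α : ℝ) : Prop :=
  ∀ A : Set X, MeasurableSet A → ν A < ∞ → ν A ≤ ν Set.univ / 2 →
    ENNReal.ofReal (1 + α) * ν A ≤ ν (T • A)

/-- The action is expanding in measure: it is `α`-expanding for some `α > 0`. -/
def IsExpandingInMeasure {Γ : Type u} [Group Γ] (T : Set Γ)
    {X : Type v} [MeasurableSpace X] [MulAction Γ X] (ν : Measure X) : Prop :=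
  ∃ α : ℝ, 0 < α ∧ IsExpandingWith T ν α

/-- The finite set `S ⊆ G`, regarded as a generating set of the subgroup `⟨S⟩`. -/
def genSet {G : Type u} [Group G] (S : Set G) : Set (Subgroup.closure S) :=
  {γ | (γ : G) ∈ S}

/-- An ergodic action of the topological group `G` on the probability space `(X, ν)`:
every `g` acts by a measurable, measure-preserving map, every measurable set that is almost invariant
under each `g` is null or conull, and the induced unitary representation
`(g · f)(x) = f (g⁻¹ x)` of `G` on `L²(X, ν)` is continuous. -/
structure IsErgodicAction (G : Type u) [Group G] [TopologicalSpace G]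
    {X : Type v} [MeasurableSpace X] [MulAction G X] (ν : Measure X) : Prop where
  isProbabilityMeasure : IsProbabilityMeasure ν
  measurableConstSMul : MeasurableConstSMul G X
  ergodicSMul : ErgodicSMul G X ν
  continuous_koopman : ∀ f : Lp ℂ 2 ν, Continuous fun g : G => DomMulAct.mk g⁻¹ • f

/-! From Kazhdan to expansion: ergodicity says that `L²` of mean zero has no invariant vectors, so
the Kazhdan pair applies to `1_A - p` with `p = ν A ≤ 1 / 2`. Its squared norm is `p (1 - p) ≥ p /
2` and its squared displacement under `s` is `2 ν (sA \ A)`, so some `s ∈ S` has `ν (sA \ A) ≥ ε² p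
/ 4`. As `1 ∈ S`, the set `S • A` contains both `A` and `sA \ A`, whence `α = ε² / 4`
(`IsKazhdanPair.isExpandingWith`).

From expansion to Kazhdan, by contraposition: if `S` is not a Kazhdan set, a Hilbert sum of
counterexamples for `ε = 1 / (n + 1)` is a real orthogonal representation with almost invariant
vectors but no invariant ones. A Cheeger inequality (`IsExpandingWith.sq_mul_integral_sq_le`) turns
expansion into a spectral gap on mean zero functions, so it suffices to realise the almost invariant
vectors as mean zero functions on an ergodic `G`-space.

The representation splits into the vectors with totally bounded orbit and their orthogonal
complement, and one summand keeps almost invariant vectors. The complement is weakly mixing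
(`exists_abs_inner_lt`), which is what makes its Gaussian action ergodic; the representation sits in
`L²` as the Gaussian variables themselves. On the other summand, cut down to a separable subspace,
the closure of the image of `G` is a compact group `K`. Translation on `K` is ergodic for Haar
measure since `G` is dense, and the coefficients `k ↦ ⟪v, k w⟫` have mean zero since there are no
invariant vectors. -/

/-! ### Cheeger inequality: expansion in measure gives a spectral gap. -/

section Cheeger

variable {G : Type u} [Group G] {X : Type v} [MeasurableSpace X] [MulAction G X]
  [MeasurableConstSMul G X] {ν : Measure X} [IsProbabilityMeasure ν] [SMulInvariantMeasure G X ν]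

/-- If the support of `h ≥ 0` has measure at most `1 / 2`, then expansion bounds `∫ h ^ 2` by the
`L¹`-displacement of `h ^ 2`. -/
theorem IsExpandingWith.mul_integral_sq_le_sum_abs {S : Finset G} {α : ℝ} (hα : 0 < α)
    (hexp : IsExpandingWith (genSet (S : Set G)) ν α) {h : X → ℝ} (hm : Measurable h)
    (hL : MemLp h 2 ν) (hnn : ∀ x, 0 ≤ h x) (hsupp : ν {x | 0 < h x} ≤ 1 / 2) :
    α * ∫ x, h x ^ 2 ∂ν ≤ ∑ s ∈ S, ∫ x, |h (s⁻¹ • x) ^ 2 - h x ^ 2| ∂ν := by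
  have hui : Integrable (fun x => h x ^ 2) ν := hL.integrable_sq
  have husi : ∀ s : G, Integrable (fun x => h (s⁻¹ • x) ^ 2) ν := fun s =>
    (measurePreserving_smul s⁻¹ ν).integrable_comp_of_integrable hui
  have hdi : ∀ s : G, Integrable (fun x => |h (s⁻¹ • x) ^ 2 - h x ^ 2|) ν := fun s =>
    ((husi s).sub hui).abs
  -- At the point `s • a` the term of index `s` compensates any drop from `h a ^ 2`, so `S • {h ^ 2
  -- > t} ⊆ {M > t}`. Expansion of each level set, integrated over `t > 0` by the layer cake
  -- formula, compares the two integrals.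
  set M : X → ℝ := fun x => h x ^ 2 + ∑ s ∈ S, |h (s⁻¹ • x) ^ 2 - h x ^ 2| with hM
  have hMi : Integrable M ν := hui.add (integrable_finsetSum _ fun s _ => hdi s)
  have hMnn : ∀ x, 0 ≤ M x := fun x =>
    add_nonneg (sq_nonneg _) (Finset.sum_nonneg fun _ _ => abs_nonneg _)
  have hle : ENNReal.ofReal (1 + α) * ∫⁻ x, ENNReal.ofReal (h x ^ 2) ∂ν
      ≤ ∫⁻ x, ENNReal.ofReal (M x) ∂ν := by
    rw [lintegral_eq_lintegral_meas_lt ν (.of_forall fun x => sq_nonneg _) hui.aemeasurable,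
      lintegral_eq_lintegral_meas_lt ν (.of_forall hMnn) hMi.aemeasurable,
      ← lintegral_const_mul' _ _ ENNReal.ofReal_ne_top]
    refine setLIntegral_mono' measurableSet_Ioi fun t ht => ?_
    have hmeas : MeasurableSet {x | t < h x ^ 2} := measurableSet_lt measurable_const (hm.pow_const 2)
    refine (hexp _ hmeas (measure_lt_top _ _) ?_).trans (measure_mono ?_)
    · rw [measure_univ]
      refine (measure_mono fun x hx => ?_).trans hsupp
      have hx' : t < h x ^ 2 := hx
      have : (0 : ℝ) < t := ht
      exact lt_of_le_of_ne (hnn x) fun h0 => by rw [← h0] at hx'; norm_num at hx'; linarith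
    · rintro _ ⟨γ, hγ, a, ha, rfl⟩
      have ha' : t < h a ^ 2 := ha
      have hγ' : (γ : G) ∈ S := hγ
      have e : (γ : G)⁻¹ • (γ • a) = a := by
        rw [Subgroup.smul_def, inv_smul_smul]
      have h1 := Finset.single_le_sum (f := fun s : G => |h (s⁻¹ • (γ • a)) ^ 2 - h (γ • a) ^ 2|)
        (fun _ _ => abs_nonneg _) hγ'
      simp only [e] at h1
      have h2 := le_abs_self (h a ^ 2 - h (γ • a) ^ 2)
      change t < h (γ • a) ^ 2 + _
      linarith
  rw [← ofReal_integral_eq_lintegral_ofReal hui (.of_forall fun x => sq_nonneg _),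
    ← ofReal_integral_eq_lintegral_ofReal hMi (.of_forall hMnn),
    ← ENNReal.ofReal_mul (by linarith), ENNReal.ofReal_le_ofReal_iff (integral_nonneg hMnn)] at hle
  rw [hM, integral_add hui (integrable_finsetSum _ fun s _ => hdi s),
    integral_finsetSum _ fun s _ => hdi s] at hle
  linarith

/-- The Cheeger inequality for a nonnegative function supported on a set of measure at most
`1 / 2`. -/
theorem IsExpandingWith.sq_mul_integral_sq_le_of_support {S : Finset G} (hS : S.Nonempty) {α : ℝ}
    (hα : 0 < α) (hexp : IsExpandingWith (genSet (S : Set G)) ν α) {h : X → ℝ} (hm : Measurable h)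
    (hL : MemLp h 2 ν) (hnn : ∀ x, 0 ≤ h x) (hsupp : ν {x | 0 < h x} ≤ 1 / 2) :
    α ^ 2 * ∫ x, h x ^ 2 ∂ν ≤ 4 * S.card * ∑ s ∈ S, ∫ x, (h (s⁻¹ • x) - h x) ^ 2 ∂ν := by
  have key := hexp.mul_integral_sq_le_sum_abs hα hm hL hnn hsupp
  have hui : Integrable (fun x => h x ^ 2) ν := hL.integrable_sq
  have hn : (0 : ℝ) < S.card := by exact_mod_cast hS.card_pos
  -- The weight in the arithmetic-geometric inequality for `|a - b| |a + b|`: with this value the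
  -- `S.card` error terms `2 * l * ∫ h ^ 2` add up to half of the left side and are absorbed there.
  set l : ℝ := α / (4 * S.card) with hl
  have hl0 : 0 < l := by positivity
  have hterm : ∀ s ∈ S, ∫ x, |h (s⁻¹ • x) ^ 2 - h x ^ 2| ∂ν ≤
      (1 / (2 * l)) * ∫ x, (h (s⁻¹ • x) - h x) ^ 2 ∂ν + 2 * l * ∫ x, h x ^ 2 ∂ν := by
    intro s _
    have mp := measurePreserving_smul s⁻¹ ν
    have hLs : MemLp (fun x => h (s⁻¹ • x)) 2 ν := hL.comp_measurePreserving mp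
    have husi : Integrable (fun x => h (s⁻¹ • x) ^ 2) ν := hLs.integrable_sq
    have hdi : Integrable (fun x => (h (s⁻¹ • x) - h x) ^ 2) ν := (hLs.sub hL).integrable_sq
    have hinv : ∫ x, h (s⁻¹ • x) ^ 2 ∂ν = ∫ x, h x ^ 2 ∂ν :=
      integral_smul_eq_self (fun x => h x ^ 2)
    calc ∫ x, |h (s⁻¹ • x) ^ 2 - h x ^ 2| ∂ν
        ≤ ∫ x, ((1 / (2 * l)) * (h (s⁻¹ • x) - h x) ^ 2
            + l * (h (s⁻¹ • x) ^ 2 + h x ^ 2)) ∂ν := by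
          refine integral_mono ((husi.sub hui).abs)
            ((hdi.const_mul _).add ((husi.add hui).const_mul _)) fun x => ?_
          have aux : ∀ a b : ℝ, |a ^ 2 - b ^ 2| ≤
              1 / (2 * l) * (a - b) ^ 2 + l * (a ^ 2 + b ^ 2) := by
            intro a b
            have h1 : a ^ 2 - b ^ 2 = (a - b) * (a + b) := by ring
            have h2 : 1 / (2 * l) * (a - b) ^ 2 + l * (a ^ 2 + b ^ 2) - (a - b) * (a + b)
                = (1 / (2 * l)) * ((a - b) - l * (a + b)) ^ 2 + l / 2 * (a - b) ^ 2 := by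
              field_simp; ring
            have h3 : 1 / (2 * l) * (a - b) ^ 2 + l * (a ^ 2 + b ^ 2) + (a - b) * (a + b)
                = (1 / (2 * l)) * ((a - b) + l * (a + b)) ^ 2 + l / 2 * (a - b) ^ 2 := by
              field_simp; ring
            have p1 : 0 ≤ (1 / (2 * l)) * ((a - b) - l * (a + b)) ^ 2 + l / 2 * (a - b) ^ 2 := by
              positivity
            have p2 : 0 ≤ (1 / (2 * l)) * ((a - b) + l * (a + b)) ^ 2 + l / 2 * (a - b) ^ 2 := by
              positivity
            rw [h1, abs_le]
            constructor <;> linarith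
          exact aux _ _
      _ = _ := by
          have hadd : Integrable (fun x => h (s⁻¹ • x) ^ 2 + h x ^ 2) ν := husi.add hui
          rw [integral_add (hdi.const_mul _) (hadd.const_mul _), integral_const_mul,
            integral_const_mul, integral_add husi hui, hinv]
          ring
  have hsum := key.trans (Finset.sum_le_sum hterm)
  rw [Finset.sum_add_distrib, ← Finset.mul_sum, Finset.sum_const, nsmul_eq_mul] at hsum
  have e1 : (S.card : ℝ) * (2 * l * ∫ x, h x ^ 2 ∂ν) = α / 2 * ∫ x, h x ^ 2 ∂ν := by
    rw [hl]; field_simp; ring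
  have e2 : 1 / (2 * l) = 2 * S.card / α := by rw [hl]; field_simp; norm_num
  rw [e1, e2] at hsum
  have h3 : α / 2 * ∫ x, h x ^ 2 ∂ν ≤ 2 * S.card / α * ∑ s ∈ S, ∫ x, (h (s⁻¹ • x) - h x) ^ 2 ∂ν := by
    linarith
  have h4 := mul_le_mul_of_nonneg_left h3 (show (0 : ℝ) ≤ 2 * α by positivity)
  have e3 : 2 * α * (2 * (S.card : ℝ) / α * ∑ s ∈ S, ∫ x, (h (s⁻¹ • x) - h x) ^ 2 ∂ν)
      = 4 * S.card * ∑ s ∈ S, ∫ x, (h (s⁻¹ • x) - h x) ^ 2 ∂ν := by field_simp; ring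
  rw [e3] at h4
  linarith

/-- Existence of a median. -/
theorem exists_median {f : X → ℝ} (hf : Measurable f) :
    ∃ m : ℝ, ν {x | f x < m} ≤ 1 / 2 ∧ ν {x | m < f x} ≤ 1 / 2 := by
  have hmono : ∀ a b : ℝ, a ≤ b → ν {x | f x < a} ≤ ν {x | f x < b} := fun a b hab =>
    measure_mono fun x (hx : f x < a) => lt_of_lt_of_le hx hab
  have hne : ∃ t : ℝ, ν {x | f x < t} ≤ 1 / 2 := by
    have ht := tendsto_measure_iInter_atTop (μ := ν) (s := fun n : ℕ => {x | f x < -(n : ℝ)})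
      (fun n => (measurableSet_lt hf measurable_const).nullMeasurableSet)
      (fun n m hnm x (hx : f x < -(m : ℝ)) => lt_of_lt_of_le hx (by
        have : (n : ℝ) ≤ m := by exact_mod_cast hnm
        linarith)) ⟨0, measure_ne_top _ _⟩
    have he : (⋂ n : ℕ, {x | f x < -(n : ℝ)}) = ∅ := by
      ext x
      simp only [Set.mem_iInter, Set.mem_empty_iff_false, iff_false, not_forall]
      obtain ⟨n, hn⟩ := exists_nat_gt (-f x)
      exact ⟨n, fun h : f x < -(n : ℝ) => by linarith⟩
    rw [he, measure_empty] at ht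
    obtain ⟨n, hn⟩ := (ht.eventually (gt_mem_nhds (show (0 : ℝ≥0∞) < 1 / 2 by norm_num))).exists
    exact ⟨_, le_of_lt hn⟩
  have hbd : ∃ t : ℝ, 1 / 2 < ν {x | f x < t} := by
    have ht := tendsto_measure_iUnion_atTop (μ := ν) (s := fun n : ℕ => {x | f x < (n : ℝ)})
      (fun n m hnm x (hx : f x < (n : ℝ)) => lt_of_lt_of_le hx (by exact_mod_cast hnm))
    have he : (⋃ n : ℕ, {x | f x < (n : ℝ)}) = Set.univ := by
      ext x
      simp only [Set.mem_iUnion, Set.mem_univ, iff_true]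
      exact exists_nat_gt (f x)
    rw [he, measure_univ] at ht
    obtain ⟨n, hn⟩ := (ht.eventually (lt_mem_nhds (show (1 / 2 : ℝ≥0∞) < 1 from
      ENNReal.one_half_lt_one.trans_eq' (by simp)))).exists
    exact ⟨_, hn⟩
  obtain ⟨b, hb⟩ := hbd
  -- The median is `sSup T`. The set is nonempty and bounded above by continuity of `ν` along the
  -- levels `-n` and `n`; both estimates pass to the limit from the levels `sSup T ∓ 1 / (n + 1)`.
  set T : Set ℝ := {t | ν {x | f x < t} ≤ 1 / 2} with hT
  have hTbd : BddAbove T := ⟨b, fun t ht => le_of_not_gt fun hbt =>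
    absurd (hb.trans_le (hmono b t hbt.le)) (not_lt.2 ht)⟩
  refine ⟨sSup T, ?_, ?_⟩
  · have ht := tendsto_measure_iUnion_atTop (μ := ν)
      (s := fun n : ℕ => {x | f x < sSup T - 1 / ((n : ℝ) + 1)})
      (fun n m hnm x (hx : f x < _) => lt_of_lt_of_le hx (by
        have := one_div_le_one_div_of_le (by positivity)
          (show (n : ℝ) + 1 ≤ m + 1 by exact_mod_cast Nat.succ_le_succ hnm)
        linarith))
    have he : (⋃ n : ℕ, {x | f x < sSup T - 1 / ((n : ℝ) + 1)}) = {x | f x < sSup T} := by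
      ext x
      simp only [Set.mem_iUnion, Set.mem_ofPred_eq]
      constructor
      · rintro ⟨n, hn⟩
        have : (0 : ℝ) < 1 / ((n : ℝ) + 1) := by positivity
        linarith
      · intro hx
        obtain ⟨n, hn⟩ := exists_nat_one_div_lt (sub_pos.2 hx)
        exact ⟨n, by linarith⟩
    rw [he] at ht
    refine le_of_tendsto' ht fun n => ?_
    obtain ⟨t, ht1, ht2⟩ := exists_lt_of_lt_csSup hne
      (show sSup T - 1 / ((n : ℝ) + 1) < sSup T from sub_lt_self _ (by positivity))
    exact (hmono _ _ ht2.le).trans ht1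
  · have ht := tendsto_measure_iUnion_atTop (μ := ν)
      (s := fun n : ℕ => {x | sSup T + 1 / ((n : ℝ) + 1) ≤ f x})
      (fun n m hnm x (hx : _ ≤ f x) => le_trans (by
        have := one_div_le_one_div_of_le (by positivity)
          (show (n : ℝ) + 1 ≤ m + 1 by exact_mod_cast Nat.succ_le_succ hnm)
        linarith) hx)
    have he : (⋃ n : ℕ, {x | sSup T + 1 / ((n : ℝ) + 1) ≤ f x}) = {x | sSup T < f x} := by
      ext x
      simp only [Set.mem_iUnion, Set.mem_ofPred_eq]
      constructor
      · rintro ⟨n, hn⟩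
        have : (0 : ℝ) < 1 / ((n : ℝ) + 1) := by positivity
        linarith
      · intro hx
        obtain ⟨n, hn⟩ := exists_nat_one_div_lt (sub_pos.2 hx)
        exact ⟨n, by linarith⟩
    rw [he] at ht
    refine le_of_tendsto' ht fun n => ?_
    have hnot : ¬ ν {x | f x < sSup T + 1 / ((n : ℝ) + 1)} ≤ 1 / 2 := fun hle =>
      absurd (le_csSup hTbd hle) (not_le.2 (lt_add_of_pos_right _ (by positivity)))
    have hc : {x | sSup T + 1 / ((n : ℝ) + 1) ≤ f x}
        = {x | f x < sSup T + 1 / ((n : ℝ) + 1)}ᶜ := by ext x; simp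
    rw [Function.comp_apply, hc, prob_compl_eq_one_sub (measurableSet_lt hf measurable_const)]
    rw [tsub_le_iff_right]
    calc (1 : ℝ≥0∞) = 1 / 2 + 1 / 2 := by simp [ENNReal.inv_two_add_inv_two]
      _ ≤ _ := by gcongr; exact (not_le.1 hnot).le

/-- The Cheeger inequality: an expanding action has a spectral gap on mean zero functions. -/
theorem IsExpandingWith.sq_mul_integral_sq_le {S : Finset G} (hS : S.Nonempty) {α : ℝ}
    (hα : 0 < α) (hexp : IsExpandingWith (genSet (S : Set G)) ν α) {f : X → ℝ} (hm : Measurable f)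
    (hL : MemLp f 2 ν) (hf0 : ∫ x, f x ∂ν = 0) :
    α ^ 2 * ∫ x, f x ^ 2 ∂ν ≤ 4 * S.card * ∑ s ∈ S, ∫ x, (f (s⁻¹ • x) - f x) ^ 2 ∂ν := by
  obtain ⟨m, hm1, hm2⟩ := exists_median (ν := ν) hm
  -- Centring at a median leaves the positive and the negative part each supported on measure at
  -- most `1 / 2`, as the preceding lemma requires.
  have hLm : MemLp (fun x => f x - m) 2 ν := hL.sub (memLp_const m)
  set p : X → ℝ := fun x => max (f x - m) 0 with hp
  set q : X → ℝ := fun x => max (-(f x - m)) 0 with hq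
  have hpL : MemLp p 2 ν := hLm.pos_part
  have hqL : MemLp q 2 ν := hLm.neg_part
  have hpm : Measurable p := (hm.sub_const m).max measurable_const
  have hqm : Measurable q := (hm.sub_const m).neg.max measurable_const
  have h1 := hexp.sq_mul_integral_sq_le_of_support hS hα hpm hpL (fun x => le_max_right _ _) (by
    refine le_trans (measure_mono fun x (hx : 0 < p x) => ?_) hm2
    have := (lt_max_iff.1 hx).resolve_right (lt_irrefl _)
    exact sub_pos.1 this)
  have h2 := hexp.sq_mul_integral_sq_le_of_support hS hα hqm hqL (fun x => le_max_right _ _) (by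
    refine le_trans (measure_mono fun x (hx : 0 < q x) => ?_) hm1
    have := (lt_max_iff.1 hx).resolve_right (lt_irrefl _)
    change f x < m
    linarith)
  -- Mean zero kills the cross term: `∫ (f - m) ^ 2 = ∫ f ^ 2 + m ^ 2`.
  have hsq : ∫ x, f x ^ 2 ∂ν ≤ ∫ x, p x ^ 2 ∂ν + ∫ x, q x ^ 2 ∂ν := by
    rw [← integral_add hpL.integrable_sq hqL.integrable_sq]
    have e : ∀ x, p x ^ 2 + q x ^ 2 = f x ^ 2 - 2 * m * f x + m ^ 2 := by
      intro x
      simp only [hp, hq]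
      rcases le_total 0 (f x - m) with h | h
      · rw [max_eq_left h, max_eq_right (by linarith)]; ring
      · rw [max_eq_right h, max_eq_left (by linarith)]; ring
    have hfi : Integrable f ν := hL.integrable (by norm_num)
    have hsub : Integrable (fun x => f x ^ 2 - 2 * m * f x) ν :=
      hL.integrable_sq.sub (hfi.const_mul _)
    simp_rw [e]
    rw [integral_add hsub (integrable_const _),
      integral_sub hL.integrable_sq (hfi.const_mul _), integral_const_mul, hf0]
    simp only [mul_zero, sub_zero, integral_const, probReal_univ, one_smul]
    nlinarith [sq_nonneg m]
  have hD : ∀ s ∈ S, ∫ x, (p (s⁻¹ • x) - p x) ^ 2 ∂ν + ∫ x, (q (s⁻¹ • x) - q x) ^ 2 ∂ν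
      ≤ ∫ x, (f (s⁻¹ • x) - f x) ^ 2 ∂ν := by
    intro s _
    have mp := measurePreserving_smul s⁻¹ ν
    have i1 : Integrable (fun x => (p (s⁻¹ • x) - p x) ^ 2) ν :=
      ((hpL.comp_measurePreserving mp).sub hpL).integrable_sq
    have i2 : Integrable (fun x => (q (s⁻¹ • x) - q x) ^ 2) ν :=
      ((hqL.comp_measurePreserving mp).sub hqL).integrable_sq
    have i3 : Integrable (fun x => (f (s⁻¹ • x) - f x) ^ 2) ν :=
      ((hL.comp_measurePreserving mp).sub hL).integrable_sq
    rw [← integral_add i1 i2]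
    refine integral_mono (i1.add i2) i3 fun x => ?_
    -- In `a - b = (a⁺ - b⁺) - (a⁻ - b⁻)` the two differences never have the same strict sign, so
    -- the omitted cross term is nonnegative.
    have aux : ∀ a b : ℝ, (max a 0 - max b 0) ^ 2 + (max (-a) 0 - max (-b) 0) ^ 2
        ≤ (a - b) ^ 2 := by
      intro a b
      rcases le_total 0 a with ha | ha <;> rcases le_total 0 b with hb | hb
      · rw [max_eq_left ha, max_eq_left hb, max_eq_right (by linarith), max_eq_right (by linarith)]
        nlinarith
      · rw [max_eq_left ha, max_eq_right hb, max_eq_right (by linarith), max_eq_left (by linarith)]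
        nlinarith
      · rw [max_eq_right ha, max_eq_left hb, max_eq_left (by linarith), max_eq_right (by linarith)]
        nlinarith
      · rw [max_eq_right ha, max_eq_right hb, max_eq_left (by linarith), max_eq_left (by linarith)]
        nlinarith
    have := aux (f (s⁻¹ • x) - m) (f x - m)
    simpa only [sub_sub_sub_cancel_right] using this
  have hDs := Finset.sum_le_sum hD
  rw [Finset.sum_add_distrib] at hDs
  have hn : (0 : ℝ) ≤ 4 * S.card := by positivity
  have h3 := mul_le_mul_of_nonneg_left hDs hn
  have h4 := mul_le_mul_of_nonneg_left hsq (sq_nonneg α)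
  rw [mul_add] at h3 h4
  linarith

end Cheeger

/-! ### Generalities on families of isometries. -/

section Isometries

variable {𝕜 : Type*} [RCLike 𝕜] {G : Type*} [Group G]
  {H : Type*} [NormedAddCommGroup H] [InnerProductSpace 𝕜 H]

/-- A multiplicative family of linear isometries indexed by a group consists of unitaries. -/
def unitaryHomOfIsometries (f : G → H →ₗᵢ[𝕜] H) (h1 : ∀ x, f 1 x = x)
    (hmul : ∀ g h x, f (g * h) x = f g (f h x)) : G →* (H ≃ₗᵢ[𝕜] H) where
  toFun g :=
    { toFun := f g
      invFun := f g⁻¹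
      left_inv := fun x => by rw [← hmul, inv_mul_cancel, h1]
      right_inv := fun x => by rw [← hmul, mul_inv_cancel, h1]
      map_add' := (f g).map_add
      map_smul' := (f g).map_smul
      norm_map' := (f g).norm_map }
  map_one' := LinearIsometryEquiv.ext h1
  map_mul' g h := LinearIsometryEquiv.ext (hmul g h)

/-- Continuity of the orbit maps of a family of linear isometries may be checked on a total set. -/
theorem continuous_isometry_apply_of_total {T : Type*} [TopologicalSpace T] (f : T → H →ₗᵢ[𝕜] H)
    {D : Set H} (hD : (Submodule.span 𝕜 D).topologicalClosure = ⊤)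
    (hc : ∀ x ∈ D, Continuous fun g => f g x) (x : H) : Continuous fun g => f g x := by
  have hspan : ∀ y ∈ Submodule.span 𝕜 D, Continuous fun g => f g y := by
    intro y hy
    induction hy using Submodule.span_induction with
    | mem y hy => exact hc y hy
    | zero => simpa using continuous_const
    | add y z _ _ hy hz => simp only [map_add]; exact hy.add hz
    | smul c y _ hy => simp only [map_smul]; exact hy.const_smul c
  -- Since each `f g` is an isometry, approximating `x` approximates the orbit map uniformly in `g`.
  refine continuous_of_uniform_approx_of_continuous fun U hU => ?_
  obtain ⟨ε, hε, hεU⟩ := Metric.mem_uniformity_dist.1 hU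
  have hx : x ∈ closure (Submodule.span 𝕜 D : Set H) := by
    rw [← Submodule.topologicalClosure_coe, hD]; trivial
  obtain ⟨y, hy, hxy⟩ := Metric.mem_closure_iff.1 hx ε hε
  exact ⟨fun g => f g y, hspan y hy, fun g => hεU (by rwa [(f g).dist_map])⟩

end Isometries

/-! ### Orthogonal representations and the vectors with totally bounded orbit. -/

/-- A strongly continuous orthogonal representation on a real inner product space. -/
structure OrthogonalRep (G : Type u) [Group G] [TopologicalSpace G]
    (H : Type v) [NormedAddCommGroup H] [InnerProductSpace ℝ H] where
  /-- The underlying homomorphism into the orthogonal group of `H`. -/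
  toHom : G →* (H ≃ₗᵢ[ℝ] H)
  /-- Every orbit map is continuous. -/
  continuous_orbit : ∀ x : H, Continuous fun g : G => toHom g x

namespace OrthogonalRep

variable {G : Type u} [Group G] [TopologicalSpace G]
  {H : Type v} [NormedAddCommGroup H] [InnerProductSpace ℝ H]

open scoped RealInnerProductSpace

/-- `0` is the only invariant vector. -/
def HasNoInvariantVectors (π : OrthogonalRep G H) : Prop :=
  ∀ x : H, (∀ g, π.toHom g x = x) → x = 0

/-- There are `(S, ε)`-invariant nonzero vectors for every `ε > 0`. -/
def HasAlmostInvariantVectors (π : OrthogonalRep G H) (S : Set G) : Prop :=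
  ∀ ε : ℝ, 0 < ε → ∃ x : H, x ≠ 0 ∧ ∀ g ∈ S, ‖π.toHom g x - x‖ ≤ ε * ‖x‖

theorem mul_apply (π : OrthogonalRep G H) (g h : G) (x : H) :
    π.toHom (g * h) x = π.toHom g (π.toHom h x) := by
  rw [map_mul]; rfl

theorem one_apply (π : OrthogonalRep G H) (x : H) : π.toHom 1 x = x := by
  rw [map_one]; rfl

theorem apply_inv_apply (π : OrthogonalRep G H) (g : G) (x : H) :
    π.toHom g (π.toHom g⁻¹ x) = x := by
  rw [← mul_apply, mul_inv_cancel, one_apply]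

theorem inner_apply_left (π : OrthogonalRep G H) (g : G) (x y : H) :
    ⟪π.toHom g x, y⟫ = ⟪x, π.toHom g⁻¹ y⟫ := by
  rw [← (π.toHom g).inner_map_map x, apply_inv_apply]

/-- The restriction to an invariant subspace. -/
noncomputable def restrict (π : OrthogonalRep G H) (N : Submodule ℝ H)
    (hN : ∀ g, ∀ x ∈ N, π.toHom g x ∈ N) : OrthogonalRep G N where
  toHom := unitaryHomOfIsometries
    (fun g =>
      { toLinearMap := (π.toHom g).toLinearEquiv.toLinearMap.restrict (hN g)
        norm_map' := fun x => (π.toHom g).norm_map x })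
    (fun x => Subtype.ext (π.one_apply x)) (fun g h x => Subtype.ext (π.mul_apply g h x))
  continuous_orbit x := (π.continuous_orbit x).subtype_mk _

theorem HasNoInvariantVectors.restrict {π : OrthogonalRep G H} (h : π.HasNoInvariantVectors)
    (N : Submodule ℝ H) (hN : ∀ g, ∀ x ∈ N, π.toHom g x ∈ N) :
    (π.restrict N hN).HasNoInvariantVectors := fun x hx =>
  Subtype.ext (h x fun g => congrArg Subtype.val (hx g))

/-- The subspace of vectors with totally bounded orbit. -/
def compactVectors (π : OrthogonalRep G H) : Submodule ℝ H where
  carrier := {x | TotallyBounded (Set.range fun g => π.toHom g x)}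
  zero_mem' := by
    refine (Set.finite_singleton (0 : H)).totallyBounded.subset ?_
    rintro _ ⟨g, rfl⟩
    simp
  add_mem' {x y} hx hy := by
    refine Metric.totallyBounded_iff.2 fun ε hε => ?_
    obtain ⟨t, ht, hcov⟩ := Metric.totallyBounded_iff.1 hx (ε / 2) (half_pos hε)
    obtain ⟨s, hs, hcov'⟩ := Metric.totallyBounded_iff.1 hy (ε / 2) (half_pos hε)
    refine ⟨t + s, ht.add hs, ?_⟩
    rintro _ ⟨g, rfl⟩
    obtain ⟨z, hz, hgz⟩ := Set.mem_iUnion₂.1 (hcov ⟨g, rfl⟩)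
    obtain ⟨w, hw, hgw⟩ := Set.mem_iUnion₂.1 (hcov' ⟨g, rfl⟩)
    refine Set.mem_iUnion₂.2 ⟨z + w, Set.add_mem_add hz hw, ?_⟩
    rw [Metric.mem_ball] at hgz hgw ⊢
    simp only [map_add]
    exact (dist_add_add_le _ _ _ _).trans_lt (by linarith)
  smul_mem' c x hx := by
    have := hx.image (uniformContinuous_const_smul (X := H) c)
    refine this.subset ?_
    rintro _ ⟨g, rfl⟩
    exact ⟨_, ⟨g, rfl⟩, by simp⟩

theorem mem_compactVectors (π : OrthogonalRep G H) {x : H} :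
    x ∈ π.compactVectors ↔ TotallyBounded (Set.range fun g => π.toHom g x) := Iff.rfl

/-- Closedness provides the orthogonal projection used to split the representation. -/
theorem isClosed_compactVectors (π : OrthogonalRep G H) :
    IsClosed (π.compactVectors : Set H) := by
  refine isClosed_of_closure_subset fun x hx => ?_
  refine (mem_compactVectors π).2 (Metric.totallyBounded_iff.2 fun ε hε => ?_)
  obtain ⟨y, hy, hxy⟩ := Metric.mem_closure_iff.1 hx (ε / 2) (half_pos hε)
  obtain ⟨t, ht, hcov⟩ := Metric.totallyBounded_iff.1 hy (ε / 2) (half_pos hε)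
  refine ⟨t, ht, ?_⟩
  rintro _ ⟨g, rfl⟩
  obtain ⟨z, hz, hgz⟩ := Set.mem_iUnion₂.1 (hcov ⟨g, rfl⟩)
  refine Set.mem_iUnion₂.2 ⟨z, hz, ?_⟩
  rw [Metric.mem_ball] at hgz ⊢
  calc dist (π.toHom g x) z ≤ dist (π.toHom g x) (π.toHom g y) + dist (π.toHom g y) z :=
        dist_triangle _ _ _
    _ < ε / 2 + ε / 2 := add_lt_add (by rwa [(π.toHom g).dist_map]) hgz
    _ = ε := add_halves ε

theorem apply_mem_compactVectors (π : OrthogonalRep G H) (g : G) (x : H)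
    (hx : x ∈ π.compactVectors) : π.toHom g x ∈ π.compactVectors := by
  refine TotallyBounded.subset ?_ hx
  rintro _ ⟨h, rfl⟩
  exact ⟨h * g, π.mul_apply h g x⟩

theorem apply_mem_orthogonal (π : OrthogonalRep G H) {N : Submodule ℝ H}
    (hN : ∀ g, ∀ x ∈ N, π.toHom g x ∈ N) (g : G) (x : H) (hx : x ∈ Nᗮ) : π.toHom g x ∈ Nᗮ := by
  rw [Submodule.mem_orthogonal'] at hx ⊢
  intro y hy
  rw [inner_apply_left]
  exact hx _ (hN _ _ hy)

/-! ### Tensors as operators; weak mixing off the compact vectors. -/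

/-- The finite rank operator attached to a tensor. -/
noncomputable def tensorToOperator (H : Type v) [NormedAddCommGroup H] [InnerProductSpace ℝ H] :
    TensorProduct ℝ H H →ₗ[ℝ] (H →L[ℝ] H) :=
  TensorProduct.lift (LinearMap.mk₂ ℝ (fun x y => (innerSL ℝ y).smulRight x)
    (fun x y z => by ext w; simp)
    (fun c x y => by ext w; simp [smul_comm c])
    (fun x y z => by ext w; simp [add_smul])
    (fun c x y => by ext w; simp [mul_smul]))

@[simp]
theorem tensorToOperator_tmul (x y z : H) :
    tensorToOperator H (TensorProduct.tmul ℝ x y) z = ⟪y, z⟫ • x := by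
  simp [tensorToOperator]

theorem inner_tensorToOperator (t : TensorProduct ℝ H H) (z w : H) :
    ⟪tensorToOperator H t z, w⟫ = ⟪t, TensorProduct.tmul ℝ w z⟫ := by
  induction t using TensorProduct.induction_on with
  | zero => simp
  | tmul x y => simp [inner_smul_left, mul_comm]
  | add t s ht hs => simp [inner_add_left, ht, hs]

/-- The operator norm is at most the Hilbert–Schmidt norm: pair `t` with `w ⊗ z` for `w` the image
of `z`. Cauchy sequences in the algebraic tensor product thereby acquire a limit in the complete
space of operators. -/
theorem norm_tensorToOperator_le (t : TensorProduct ℝ H H) : ‖tensorToOperator H t‖ ≤ ‖t‖ := by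
  refine ContinuousLinearMap.opNorm_le_bound _ (norm_nonneg _) fun z => ?_
  set w := tensorToOperator H t z with hw
  have h1 : ‖w‖ * ‖w‖ ≤ ‖t‖ * (‖w‖ * ‖z‖) := by
    have e : ‖TensorProduct.tmul ℝ w z‖ = ‖w‖ * ‖z‖ := by simp
    rw [← real_inner_self_eq_norm_mul_norm, ← e]
    conv_lhs => rw [hw, inner_tensorToOperator, ← hw]
    exact real_inner_le_norm t (TensorProduct.tmul ℝ w z)
  rcases (norm_nonneg w).eq_or_lt with h | h
  · rw [← h]; positivity
  · nlinarith

theorem isCompactOperator_tensorToOperator (t : TensorProduct ℝ H H) :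
    IsCompactOperator (tensorToOperator H t) := by
  induction t using TensorProduct.induction_on with
  | zero => simpa using isCompactOperator_zero
  | tmul x y =>
    have h := (isCompactOperator_of_locallyCompactSpace_dom (innerSL ℝ y)).clm_comp
      (ContinuousLinearMap.toSpanSingleton ℝ x)
    have e : ⇑(tensorToOperator H (TensorProduct.tmul ℝ x y))
        = ContinuousLinearMap.toSpanSingleton ℝ x ∘ innerSL ℝ y := by
      ext z
      simp
    rw [e]
    exact h
  | add t s ht hs => simpa using ht.add hs

/-- Moving a tensor by `g ⊗ g` conjugates its operator by `g`; nearly invariant tensors thus give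
nearly commuting operators. -/
theorem tensorToOperator_map (π : OrthogonalRep G H) (g : G) (t : TensorProduct ℝ H H) (z : H) :
    tensorToOperator H (TensorProduct.mapIsometry (π.toHom g).toLinearIsometry
      (π.toHom g).toLinearIsometry t) (π.toHom g z) = π.toHom g (tensorToOperator H t z) := by
  induction t using TensorProduct.induction_on with
  | zero => simp
  | tmul x y => simp
  | add t s ht hs =>
    rw [map_add, map_add, map_add, _root_.add_apply, _root_.add_apply,
      ht, hs, map_add]

/-- In a convex set, two points of almost minimal norm are close. -/
theorem norm_sub_sq_le_of_convex {E : Type*} [NormedAddCommGroup E] [InnerProductSpace ℝ E]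
    {C : Set E} (hC : Convex ℝ C) {d η : ℝ} (hd : 0 ≤ d) (hmin : ∀ t ∈ C, d ≤ ‖t‖) {s t : E}
    (hs : s ∈ C) (ht : t ∈ C) (hs' : ‖s‖ ^ 2 ≤ d ^ 2 + η) (ht' : ‖t‖ ^ 2 ≤ d ^ 2 + η) :
    ‖s - t‖ ^ 2 ≤ 4 * η := by
  have hmid : (1 / 2 : ℝ) • s + (1 / 2 : ℝ) • t ∈ C :=
    hC hs ht (by norm_num) (by norm_num) (by norm_num)
  have h1 := hmin _ hmid
  rw [← smul_add, norm_smul] at h1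
  norm_num at h1
  have h2 := parallelogram_law_with_norm ℝ s t
  have h3 : (2 * d) ^ 2 ≤ ‖s + t‖ ^ 2 := pow_le_pow_left₀ (by positivity) (by linarith) 2
  nlinarith

theorem convex_setOf_le_inner {E : Type*} [NormedAddCommGroup E] [InnerProductSpace ℝ E]
    (p : E) (c : ℝ) : Convex ℝ {t : E | c ≤ ⟪t, p⟫} := by
  intro s hs t ht a b ha hb hab
  change c ≤ ⟪a • s + b • t, p⟫
  have hs' : c ≤ ⟪s, p⟫ := hs
  have ht' : c ≤ ⟪t, p⟫ := ht
  rw [inner_add_left, real_inner_smul_left, real_inner_smul_left]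
  calc c = a * c + b * c := by rw [← add_mul, hab, one_mul]
    _ ≤ _ := add_le_add (mul_le_mul_of_nonneg_left hs' ha) (mul_le_mul_of_nonneg_left ht' hb)

/-- A representation without nonzero compact vectors is weakly mixing. -/
theorem exists_abs_inner_lt [CompleteSpace H] (π : OrthogonalRep G H)
    (hno : ∀ x, TotallyBounded (Set.range fun g => π.toHom g x) → x = 0)
    (F : Finset H) {ε : ℝ} (hε : 0 < ε) :
    ∃ g, ∀ x ∈ F, ∀ y ∈ F, |⟪π.toHom g x, y⟫| < ε := by
  -- Otherwise the orbit of `p = ∑ x ⊗ x` stays in the half-space `⟪t, p⟫ ≥ ε ^ 2`, and so does its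
  -- convex hull `C`. Elements of almost minimal norm in `C` are almost invariant; their operators
  -- converge to a compact operator commuting with `π`, which has to vanish, although the half-space
  -- condition survives the limit.
  by_contra! hcon
  set U : G → TensorProduct ℝ H H →ₗᵢ[ℝ] TensorProduct ℝ H H := fun g =>
    TensorProduct.mapIsometry (π.toHom g).toLinearIsometry (π.toHom g).toLinearIsometry with hU
  have hUmul : ∀ g h t, U g (U h t) = U (g * h) t := by
    intro g h t
    induction t using TensorProduct.induction_on with
    | zero => simp
    | tmul x y => simp [hU]
    | add t s ht hs => simp only [map_add, ht, hs]
  set p : TensorProduct ℝ H H := ∑ x ∈ F, TensorProduct.tmul ℝ x x with hp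
  set C : Set (TensorProduct ℝ H H) := convexHull ℝ (Set.range fun g => U g p) with hCdef
  have hCconv : Convex ℝ C := convex_convexHull _ _
  have hCne : C.Nonempty := ⟨_, subset_convexHull _ _ ⟨1, rfl⟩⟩
  have hCinv : ∀ g, ∀ t ∈ C, U g t ∈ C := by
    intro g t ht
    have : U g '' C = convexHull ℝ (U g '' Set.range fun h => U h p) :=
      (U g).toLinearMap.image_convexHull _
    have hmem : U g t ∈ U g '' C := ⟨t, ht, rfl⟩
    rw [this] at hmem
    refine convexHull_mono ?_ hmem
    rintro _ ⟨_, ⟨h, rfl⟩, rfl⟩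
    exact ⟨g * h, (hUmul g h p).symm⟩
  have hCp : ∀ t ∈ C, ε ^ 2 ≤ ⟪t, p⟫ := by
    have hconv : Convex ℝ {t : TensorProduct ℝ H H | ε ^ 2 ≤ ⟪t, p⟫} :=
      convex_setOf_le_inner (E := TensorProduct ℝ H H) p (ε ^ 2)
    refine fun t ht => convexHull_min ?_ hconv ht
    rintro _ ⟨g, rfl⟩
    obtain ⟨x, hx, y, hy, hxy⟩ := hcon g
    change ε ^ 2 ≤ ⟪U g p, p⟫
    -- Passing to the tensor square replaces coefficients by their squares, so no cancellation can
    -- occur.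
    have : ⟪U g p, p⟫ = ∑ x ∈ F, ∑ y ∈ F, ⟪π.toHom g x, y⟫ ^ 2 := by
      rw [hp, map_sum, sum_inner]
      refine Finset.sum_congr rfl fun x _ => ?_
      rw [inner_sum]
      refine Finset.sum_congr rfl fun y _ => ?_
      simp [hU, sq]
    rw [this]
    calc ε ^ 2 ≤ |⟪π.toHom g x, y⟫| ^ 2 := pow_le_pow_left₀ hε.le hxy 2
      _ = ⟪π.toHom g x, y⟫ ^ 2 := sq_abs _
      _ ≤ ∑ y ∈ F, ⟪π.toHom g x, y⟫ ^ 2 :=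
        Finset.single_le_sum (f := fun y => ⟪π.toHom g x, y⟫ ^ 2) (fun _ _ => sq_nonneg _) hy
      _ ≤ _ := Finset.single_le_sum (f := fun x => ∑ y ∈ F, ⟪π.toHom g x, y⟫ ^ 2)
        (fun _ _ => Finset.sum_nonneg fun _ _ => sq_nonneg _) hx
  set d : ℝ := sInf ((fun t => ‖t‖) '' C) with hd
  have hbdd : BddBelow ((fun t => ‖t‖) '' C) := ⟨0, by rintro _ ⟨t, _, rfl⟩; exact norm_nonneg t⟩
  have hd0 : 0 ≤ d := Real.sInf_nonneg (by rintro _ ⟨t, _, rfl⟩; exact norm_nonneg t)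
  have hmin : ∀ t ∈ C, d ≤ ‖t‖ := fun t ht => csInf_le hbdd ⟨t, ht, rfl⟩
  have hseq : ∀ n : ℕ, ∃ t ∈ C, ‖t‖ ^ 2 ≤ d ^ 2 + 1 / ((n : ℝ) + 1) := by
    intro n
    have hlt : d < Real.sqrt (d ^ 2 + 1 / ((n : ℝ) + 1)) :=
      Real.lt_sqrt_of_sq_lt (lt_add_of_pos_right _ (by positivity))
    obtain ⟨_, ⟨t, ht, rfl⟩, hlt'⟩ := exists_lt_of_csInf_lt (hCne.image _) hlt
    refine ⟨t, ht, ?_⟩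
    calc ‖t‖ ^ 2 ≤ Real.sqrt (d ^ 2 + 1 / ((n : ℝ) + 1)) ^ 2 :=
          pow_le_pow_left₀ (norm_nonneg t) hlt'.le 2
      _ = _ := Real.sq_sqrt (by positivity)
  choose t htC ht using hseq
  have hδ : Filter.Tendsto (fun n : ℕ => Real.sqrt (4 * (1 / ((n : ℝ) + 1)))) Filter.atTop
      (nhds 0) := by
    have := (tendsto_one_div_add_atTop_nhds_zero_nat (𝕜 := ℝ)).const_mul 4
    simpa using this.sqrt
  have hclose : ∀ (n : ℕ) (s s' : TensorProduct ℝ H H), s ∈ C → s' ∈ C →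
      ‖s‖ ^ 2 ≤ d ^ 2 + 1 / ((n : ℝ) + 1) → ‖s'‖ ^ 2 ≤ d ^ 2 + 1 / ((n : ℝ) + 1) →
      ‖s - s'‖ ≤ Real.sqrt (4 * (1 / ((n : ℝ) + 1))) := fun n s s' hs hs' h h' =>
    Real.le_sqrt_of_sq_le (norm_sub_sq_le_of_convex hCconv hd0 hmin hs hs' h h')
  set Q : ℕ → H →L[ℝ] H := fun n => tensorToOperator H (t n) with hQ
  have hcauchy : CauchySeq Q := by
    refine cauchySeq_of_le_tendsto_0' _ (fun n m hnm => ?_) hδ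
    rw [dist_eq_norm, hQ]
    simp only
    rw [← map_sub]
    refine (norm_tensorToOperator_le _).trans (hclose n _ _ (htC n) (htC m) (ht n) ?_)
    refine (ht m).trans (by gcongr)
  obtain ⟨Q₀, hQ₀⟩ := cauchySeq_tendsto_of_complete hcauchy
  have hcomp : IsCompactOperator Q₀ :=
    isCompactOperator_of_tendsto hQ₀ (.of_forall fun n => isCompactOperator_tensorToOperator _)
  have happ : ∀ z, Filter.Tendsto (fun n => Q n z) Filter.atTop (nhds (Q₀ z)) := fun z =>
    ((ContinuousLinearMap.apply ℝ H z).continuous.tendsto Q₀).comp hQ₀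
  -- `U g (t n)` lies in `C` and has the same norm as `t n`, hence is close to it by the
  -- parallelogram estimate.
  have hcomm : ∀ g z, Q₀ (π.toHom g z) = π.toHom g (Q₀ z) := by
    intro g z
    have h1 := happ (π.toHom g z)
    have h2 := ((π.toHom g).continuous.tendsto (Q₀ z)).comp (happ z)
    refine eq_of_sub_eq_zero (tendsto_nhds_unique (h1.sub h2) ?_)
    refine squeeze_zero_norm (a := fun n : ℕ => Real.sqrt (4 * (1 / ((n : ℝ) + 1))) * ‖z‖)
      (fun n => ?_) (by simpa using hδ.mul_const ‖z‖)
    have e : Q n (π.toHom g z) - π.toHom g (Q n z)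
        = tensorToOperator H (t n - U g (t n)) (π.toHom g z) := by
      rw [map_sub, _root_.sub_apply, hU, tensorToOperator_map]
    change ‖Q n (π.toHom g z) - π.toHom g (Q n z)‖ ≤ _
    rw [e]
    refine (ContinuousLinearMap.le_opNorm _ _).trans ?_
    rw [(π.toHom g).norm_map]
    refine mul_le_mul_of_nonneg_right ((norm_tensorToOperator_le _).trans ?_) (norm_nonneg _)
    exact hclose n _ _ (htC n) (hCinv g _ (htC n)) (ht n) (by rw [(U g).norm_map]; exact ht n)
  -- The orbit of `Q₀ z` is the image under `Q₀` of the orbit of `z`, a bounded set; compactness of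
  -- `Q₀` makes it totally bounded.
  have hzero : ∀ z, Q₀ z = 0 := by
    intro z
    refine hno _ ?_
    obtain ⟨K, hK, hKz⟩ := IsCompactOperator.image_closedBall_subset_compact
      (𝕜₁ := ℝ) (𝕜₂ := ℝ) (f := (Q₀ : H →ₗ[ℝ] H)) hcomp ‖z‖
    refine hK.totallyBounded.subset ?_
    rintro _ ⟨g, rfl⟩
    refine hKz ⟨π.toHom g z, ?_, hcomm g z⟩
    simp
  have hsum : Filter.Tendsto (fun n => ∑ x ∈ F, ⟪Q n x, x⟫) Filter.atTop
      (nhds (∑ x ∈ F, ⟪Q₀ x, x⟫)) :=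
    tendsto_finsetSum _ fun x _ => (happ x).inner tendsto_const_nhds
  have hge : ε ^ 2 ≤ ∑ x ∈ F, ⟪Q₀ x, x⟫ := by
    refine ge_of_tendsto' hsum fun n => ?_
    have := hCp _ (htC n)
    rw [hp, inner_sum] at this
    simpa only [hQ, inner_tensorToOperator] using this
  simp only [hzero, inner_zero_left, Finset.sum_const_zero] at hge
  nlinarith

end OrthogonalRep

/-! ### Characteristic functionals and Gaussian Hilbert spaces. -/

section Gaussian

open ProbabilityTheory Complex
open scoped RealInnerProductSpace NNReal

/-- The linear functional `ω ↦ ∑ t x * ω x` on a space of real functions. -/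
noncomputable def evalComb {J : Type*} (t : J →₀ ℝ) (ω : J → ℝ) : ℝ := t.sum fun x c => c * ω x

@[fun_prop]
theorem measurable_evalComb {J : Type*} (t : J →₀ ℝ) : Measurable (evalComb t) := by
  unfold evalComb Finsupp.sum
  fun_prop

@[simp]
theorem evalComb_zero {J : Type*} (ω : J → ℝ) : evalComb 0 ω = 0 := by simp [evalComb]

theorem evalComb_add {J : Type*} (t u : J →₀ ℝ) (ω : J → ℝ) :
    evalComb (t + u) ω = evalComb t ω + evalComb u ω := by
  classical
  exact Finsupp.sum_add_index' (by simp) (by intros; ring)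

theorem evalComb_smul {J : Type*} (c : ℝ) (t : J →₀ ℝ) (ω : J → ℝ) :
    evalComb (c • t) ω = c * evalComb t ω := by
  unfold evalComb
  rw [Finsupp.sum_smul_index (by simp), Finsupp.mul_sum]
  simp only [mul_assoc]

theorem evalComb_neg {J : Type*} (t : J →₀ ℝ) (ω : J → ℝ) :
    evalComb (-t) ω = -evalComb t ω := by
  rw [← neg_one_smul ℝ t, evalComb_smul, neg_one_mul]

theorem evalComb_sub {J : Type*} (t u : J →₀ ℝ) (ω : J → ℝ) :
    evalComb (t - u) ω = evalComb t ω - evalComb u ω := by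
  rw [sub_eq_add_neg, evalComb_add, evalComb_neg, sub_eq_add_neg]

/-- Finite measures on `J → ℝ` are determined by their characteristic functionals. -/
theorem ext_of_integral_exp_evalComb {J : Type*} {μ ν : Measure (J → ℝ)} [IsFiniteMeasure μ]
    [IsFiniteMeasure ν]
    (h : ∀ t : J →₀ ℝ, ∫ ω, cexp (evalComb t ω * I) ∂μ = ∫ ω, cexp (evalComb t ω * I) ∂ν) :
    μ = ν := by
  classical
  have hP : IsProjectiveLimit μ (fun F : Finset J => μ.map F.restrict) := fun F => rfl
  refine hP.unique fun F => ?_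
  refine Measure.ext_of_charFunDual (funext fun L => ?_)
  rw [charFunDual_apply, charFunDual_apply, integral_map (by fun_prop)
    (Measurable.aestronglyMeasurable (by fun_prop)), integral_map (by fun_prop)
    (Measurable.aestronglyMeasurable (by fun_prop))]
  -- Finite-dimensional marginals determine the measure, and each functional `L` of a marginal is a
  -- finite combination of evaluations.
  set t : J →₀ ℝ := ∑ j : F, Finsupp.single (j : J) (L (Pi.single j 1)) with ht
  have hL : ∀ ω : J → ℝ, L (F.restrict ω) = evalComb t ω := by
    intro ω
    have h1 : F.restrict ω = ∑ j : F, ω j • (Pi.single j 1 : F → ℝ) := by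
      ext i
      simp [Finset.sum_apply, Pi.single_apply]
    have h2 : ∀ s : Finset F, evalComb (∑ j ∈ s, Finsupp.single (j : J) (L (Pi.single j 1))) ω
        = ∑ j ∈ s, L (Pi.single j 1) * ω j := by
      intro s
      induction s using Finset.induction_on with
      | empty => simp
      | insert a s ha ih =>
        rw [Finset.sum_insert ha, Finset.sum_insert ha, evalComb_add, ih]
        congr 1
        simp [evalComb]
    rw [ht, h2, h1, map_sum]
    refine Finset.sum_congr rfl fun j _ => ?_
    rw [map_smul, smul_eq_mul, mul_comm]
  simp only [hL]
  exact (h t).symm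

theorem norm_exp_mul_I_sub_le (a b : ℝ) : ‖cexp (a * I) - cexp (b * I)‖ ≤ |a - b| := by
  have e : cexp (a * I) - cexp (b * I) = cexp (b * I) * (cexp (I * ((a - b : ℝ) : ℂ)) - 1) := by
    rw [mul_sub, ← Complex.exp_add, mul_one]
    congr 2
    push_cast
    ring
  rw [e, norm_mul, Complex.norm_exp_ofReal_mul_I, one_mul]
  exact Real.norm_exp_I_mul_ofReal_sub_one_le

theorem integral_abs_le_norm_Lp {Ω : Type*} [MeasurableSpace Ω] {P : Measure Ω}
    [IsProbabilityMeasure P] (f : Lp ℝ 2 P) : ∫ ω, |f ω| ∂P ≤ ‖f‖ := by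
  have h1 : ∫ ω, |f ω| ∂P = (eLpNorm f 1 P).toReal := by
    rw [eLpNorm_one_eq_lintegral_enorm, ← integral_norm_eq_lintegral_enorm
      (Lp.aestronglyMeasurable f)]
    rfl
  rw [h1, Lp.norm_def]
  exact ENNReal.toReal_mono (Lp.eLpNorm_ne_top f)
    (eLpNorm_le_eLpNorm_of_exponent_le (by norm_num) (Lp.aestronglyMeasurable f))

/-- The map is 1-Lipschitz, from `|e^{ia} - e^{ib}| ≤ |a - b|` and `L¹ ≤ L²`. It carries the
Gaussian formula from a dense subspace to all vectors. -/
theorem continuous_integral_exp_Lp {Ω : Type*} [MeasurableSpace Ω] (P : Measure Ω)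
    [IsProbabilityMeasure P] :
    Continuous fun f : Lp ℝ 2 P => ∫ ω, cexp (f ω * I) ∂P := by
  have hint : ∀ f : Lp ℝ 2 P, Integrable (fun ω => cexp (f ω * I)) P := by
    intro f
    refine (integrable_const (1 : ℝ)).mono' ?_ (.of_forall fun ω => ?_)
    · have := (Lp.stronglyMeasurable f).measurable
      exact Measurable.aestronglyMeasurable (by fun_prop)
    · rw [Complex.norm_exp_ofReal_mul_I]
  refine LipschitzWith.continuous (K := 1) (LipschitzWith.of_dist_le_mul fun f g => ?_)
  rw [dist_eq_norm, dist_eq_norm, ← integral_sub (hint f) (hint g), NNReal.coe_one, one_mul]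
  refine (norm_integral_le_integral_norm _).trans (le_trans ?_ (integral_abs_le_norm_Lp (f - g)))
  refine integral_mono_ae ((hint f).sub (hint g)).norm
    ((Lp.memLp (f - g)).integrable (by norm_num)).abs ?_
  filter_upwards [Lp.coeFn_sub f g] with ω hω
  rw [hω]
  exact norm_exp_mul_I_sub_le _ _

theorem integral_exp_sum_infinitePi_gaussianReal {ι : Type*} (s : Finset ι) (a : ι → ℝ) :
    ∫ ω, cexp (((∑ i ∈ s, a i * ω i : ℝ) : ℂ) * I)
      ∂(Measure.infinitePi fun _ : ι => gaussianReal 0 1)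
      = cexp (-((∑ i ∈ s, a i ^ 2 : ℝ) : ℂ) / 2) := by
  have hind : iIndepFun (fun (i : ι) (ω : ι → ℝ) => a i * ω i)
      (Measure.infinitePi fun _ : ι => gaussianReal 0 1) :=
    iIndepFun_infinitePi (P := fun _ : ι => gaussianReal 0 1)
      (X := fun i (x : ℝ) => a i * x) (fun i => by fun_prop)
  have h := congrFun (iIndepFun.charFun_map_fun_finsetSum_eq_prod (s := s)
    (fun i _ => (by fun_prop : Measurable fun ω : ι → ℝ => a i * ω i).aemeasurable)
    (hind.restrict s)) 1
  have hsm : Measurable fun ω : ι → ℝ => ∑ i ∈ s, a i * ω i :=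
    Finset.measurable_sum _ fun i _ =>
      Measurable.const_mul (show Measurable fun ω : ι → ℝ => ω i from measurable_pi_apply i) (a i)
  rw [charFun_apply_real, integral_map hsm.aemeasurable
    (Measurable.aestronglyMeasurable (by fun_prop))] at h
  simp only [ofReal_one, one_mul, Finset.prod_apply] at h
  rw [h]
  have e : ∀ i, charFun ((Measure.infinitePi fun _ : ι => gaussianReal 0 1).map
      (fun ω : ι → ℝ => a i * ω i)) 1 = cexp (-((a i ^ 2 : ℝ) : ℂ) / 2) := by
    intro i
    rw [charFun_map_mul_comp (f := fun ω : ι → ℝ => ω i) (measurable_pi_apply i).aemeasurable,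
      Measure.infinitePi_map_eval, charFun_gaussianReal]
    congr 1
    push_cast
    ring
  simp only [e]
  rw [← Complex.exp_sum]
  congr 1
  push_cast
  rw [← Finset.sum_div, Finset.sum_neg_distrib]

/-- A standard Gaussian family: a linear isometry from a Hilbert space into an `L²` space all of
whose values are centered Gaussian. -/
theorem exists_gaussian_isometry (H : Type v) [NormedAddCommGroup H] [InnerProductSpace ℝ H]
    [CompleteSpace H] : ∃ (Ω : Type v) (_ : MeasurableSpace Ω) (P : Measure Ω)
      (_ : IsProbabilityMeasure P) (T : H →ₗᵢ[ℝ] Lp ℝ 2 P),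
      ∀ x, ∫ ω, cexp (T x ω * I) ∂P = cexp (-((‖x‖ ^ 2 : ℝ) : ℂ) / 2) := by
  classical
  obtain ⟨ι, b, -⟩ := exists_hilbertBasis ℝ H
  -- Independent standard Gaussian coordinates indexed by a Hilbert basis are orthonormal in `L²`,
  -- so sending the basis to the coordinates extends to an isometry.
  set P : Measure (ι → ℝ) := Measure.infinitePi fun _ : ι => gaussianReal 0 1 with hP
  have hmp : ∀ i : ι, MeasurePreserving (Function.eval i) P (gaussianReal 0 1) :=
    fun i => measurePreserving_eval_infinitePi (fun _ : ι => gaussianReal 0 1) i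
  have hmem : ∀ i : ι, MemLp (fun ω : ι → ℝ => ω i) 2 P := fun i =>
    (memLp_id_gaussianReal 2).comp_measurePreserving (hmp i)
  have hmean : ∀ i : ι, ∫ ω, ω i ∂P = 0 := fun i => by
    have := integral_map (μ := P) (hmp i).measurable.aemeasurable
      (f := fun x : ℝ => x) (measurable_id.aestronglyMeasurable)
    rw [(hmp i).map_eq, integral_id_gaussianReal] at this
    exact this.symm
  have hsq : ∀ i : ι, ∫ ω, ω i * ω i ∂P = 1 := fun i => by
    have := integral_map (μ := P) (hmp i).measurable.aemeasurable
      (f := fun x : ℝ => x * x) (Measurable.aestronglyMeasurable (by fun_prop))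
    rw [(hmp i).map_eq] at this
    refine this.symm.trans ?_
    have hv := variance_fun_id_gaussianReal (μ := 0) (v := 1)
    rw [variance_eq_integral measurable_id'.aemeasurable, integral_id_gaussianReal] at hv
    simpa [sq] using hv
  have hind : iIndepFun (fun (i : ι) (ω : ι → ℝ) => ω i) P :=
    iIndepFun_infinitePi (P := fun _ : ι => gaussianReal 0 1)
      (X := fun i (x : ℝ) => x) (fun i => measurable_id)
  have hon : Orthonormal ℝ fun i : ι => (hmem i).toLp := by
    rw [orthonormal_iff_ite]
    intro i j
    have e : ⟪(hmem i).toLp, (hmem j).toLp⟫ = ∫ ω, ω i * ω j ∂P := by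
      rw [L2.inner_def]
      refine integral_congr_ae ?_
      filter_upwards [(hmem i).coeFn_toLp, (hmem j).coeFn_toLp] with ω h1 h2
      rw [h1, h2]
      simp [mul_comm]
    rw [e]
    split_ifs with hij
    · rw [hij, hsq]
    · have := (hind.indepFun hij).integral_mul_eq_mul_integral
        (hmem i).aestronglyMeasurable (hmem j).aestronglyMeasurable
      simp only [Pi.mul_apply, hmean, mul_zero] at this
      exact this
  set V := Orthonormal.orthogonalFamily hon
  set T : H →ₗᵢ[ℝ] Lp ℝ 2 P := V.linearIsometry.comp b.repr.toLinearIsometry with hT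
  have hTb : ∀ i, T (b i) = (hmem i).toLp := by
    intro i
    change V.linearIsometry (b.repr (b i)) = _
    rw [b.repr_self, OrthogonalFamily.linearIsometry_apply_single]
    simp
  refine ⟨ι → ℝ, inferInstance, P, inferInstance, T, fun x => ?_⟩
  have hclosed : IsClosed {x : H | ∫ ω, cexp (T x ω * I) ∂P = cexp (-((‖x‖ ^ 2 : ℝ) : ℂ) / 2)} :=
    isClosed_eq ((continuous_integral_exp_Lp P).comp T.continuous) (by fun_prop)
  have hsub : (Submodule.span ℝ (Set.range b) : Set H) ⊆
      {x : H | ∫ ω, cexp (T x ω * I) ∂P = cexp (-((‖x‖ ^ 2 : ℝ) : ℂ) / 2)} := by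
    intro y hy
    obtain ⟨c, rfl⟩ := (Finsupp.mem_span_range_iff_exists_finsupp).1 hy
    have hae : (T (c.sum fun i a => a • b i) : (ι → ℝ) → ℝ) =ᵐ[P]
        fun ω => ∑ i ∈ c.support, c i * ω i := by
      have e : T (c.sum fun i a => a • b i)
          = ∑ i ∈ c.support, c i • (hmem i).toLp := by
        rw [Finsupp.sum, map_sum]
        exact Finset.sum_congr rfl fun i _ => by rw [map_smul, hTb]
      rw [e]
      refine (Lp.coeFn_finsetSum _ _).trans ?_
      have hall : ∀ᵐ ω ∂P, ∀ i ∈ c.support, (c i • (hmem i).toLp : Lp ℝ 2 P) ω = c i * ω i := by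
        refine (Filter.eventually_all_finset _).2 fun i _ => ?_
        filter_upwards [Lp.coeFn_smul (c i) (hmem i).toLp, (hmem i).coeFn_toLp] with ω h1 h2
        rw [h1, Pi.smul_apply, h2, smul_eq_mul]
      filter_upwards [hall] with ω hω
      rw [Finset.sum_apply]
      exact Finset.sum_congr rfl hω
    have hn : ‖c.sum fun i a => a • b i‖ ^ 2 = ∑ i ∈ c.support, c i ^ 2 := by
      rw [← real_inner_self_eq_norm_sq, Finsupp.sum, b.orthonormal.inner_sum]
      simp [sq]
    change ∫ ω, _ ∂P = _
    rw [hn, ← integral_exp_sum_infinitePi_gaussianReal]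
    refine integral_congr_ae ?_
    filter_upwards [hae] with ω hω
    rw [hω]
  have hx : x ∈ closure (Submodule.span ℝ (Set.range b) : Set H) := by
    rw [← Submodule.topologicalClosure_coe, b.dense_span]; trivial
  exact hclosed.closure_subset_iff.2 hsub hx

end Gaussian

/-! ### Koopman representations and a criterion for ergodicity. -/

section Koopman

variable {G : Type u} [Group G] {X : Type v} [MeasurableSpace X] [MulAction G X]
  [MeasurableConstSMul G X] (ν : Measure X) [SMulInvariantMeasure G X ν]

/-- The Koopman representation on `L²`, as a family of isometries. -/
noncomputable def koopman (g : G) : Lp ℂ 2 ν →ₗᵢ[ℂ] Lp ℂ 2 ν where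
  toFun f := DomMulAct.mk g⁻¹ • f
  map_add' := smul_add _
  map_smul' _ _ := smul_comm _ _ _
  norm_map' _ := DomMulAct.norm_smul_Lp _ _

theorem koopman_one (f : Lp ℂ 2 ν) : koopman ν (1 : G) f = f := by
  change DomMulAct.mk (1 : G)⁻¹ • f = f
  rw [inv_one, DomMulAct.mk_one, one_smul]

theorem koopman_mul (g h : G) (f : Lp ℂ 2 ν) :
    koopman ν (g * h) f = koopman ν g (koopman ν h f) := by
  change DomMulAct.mk (g * h)⁻¹ • f = DomMulAct.mk g⁻¹ • DomMulAct.mk h⁻¹ • f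
  rw [mul_inv_rev, DomMulAct.mk_mul, mul_smul]

theorem koopman_toLp (g : G) {f : X → ℂ} (hf : MemLp f 2 ν) :
    koopman ν g hf.toLp = (hf.comp_measurePreserving (measurePreserving_smul g⁻¹ ν)).toLp :=
  DomMulAct.mk_smul_toLp g⁻¹ hf

theorem koopman_ae_eq (g : G) (f : Lp ℂ 2 ν) :
    koopman ν g f =ᵐ[ν] fun x => f (g⁻¹ • x) :=
  DomMulAct.smul_Lp_ae_eq _ f

variable [IsProbabilityMeasure ν]

theorem inner_const_one (f : Lp ℂ 2 ν) :
    inner ℂ (Lp.const 2 ν (1 : ℂ)) f = ∫ x, f x ∂ν := by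
  rw [L2.inner_def]
  refine integral_congr_ae ?_
  filter_upwards [Lp.coeFn_const (p := 2) (μ := ν) (1 : ℂ)] with x hx
  rw [hx]
  simp

variable (G) in
/-- An action is ergodic as soon as its Koopman representation has no invariant vectors of mean
zero. -/
theorem ergodicSMul_of_koopman
    (h : ∀ f : Lp ℂ 2 ν, (∀ g : G, koopman ν g f = f) → ∫ x, f x ∂ν = 0 → f = 0) :
    ErgodicSMul G X ν := by
  refine ⟨fun {s} hs hinv => ?_⟩
  have hfs : MemLp (s.indicator fun _ => (1 : ℂ)) 2 ν :=
    memLp_indicator_const 2 hs 1 (Or.inr (measure_ne_top _ _))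
  -- The centred indicator of an almost invariant set is an invariant vector of mean zero.
  set c : ℂ := ∫ x, s.indicator (fun _ => (1 : ℂ)) x ∂ν with hc
  have hf : MemLp (fun x => s.indicator (fun _ => (1 : ℂ)) x - c) 2 ν := hfs.sub (memLp_const c)
  have h0 := h hf.toLp (fun g => by
    rw [koopman_toLp]
    refine MemLp.toLp_congr _ _ ?_
    filter_upwards [hinv g⁻¹] with x hx
    have hx' : g⁻¹ • x ∈ s ↔ x ∈ s := Iff.of_eq hx
    by_cases hxs : x ∈ s
    · simp [Set.indicator, hxs, hx'.mpr hxs]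
    · simp [Set.indicator, hxs, mt hx'.mp hxs]) (by
    rw [integral_congr_ae hf.coeFn_toLp, integral_sub (hfs.integrable (by norm_num))
      (integrable_const _)]
    simp [hc])
  have hae : ∀ᵐ x ∂ν, s.indicator (fun _ => (1 : ℂ)) x = c := by
    have h1 := hf.coeFn_toLp
    rw [h0] at h1
    filter_upwards [h1, Lp.coeFn_zero ℂ 2 ν] with x hx hx0
    rw [hx0] at hx
    exact (sub_eq_zero.1 hx.symm)
  rw [Filter.eventuallyConst_set]
  by_cases h1 : c = 1
  · left
    filter_upwards [hae] with x hx
    by_contra hxs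
    rw [Set.indicator_of_notMem hxs, h1] at hx
    exact zero_ne_one hx
  · right
    filter_upwards [hae] with x hx hxs
    rw [Set.indicator_of_mem hxs] at hx
    exact h1 hx.symm

end Koopman

/-- If a total family of vectors decorrelates from the invariant unit vector `o`, then invariant
vectors orthogonal to `o` vanish. -/
theorem eq_zero_of_invariant_of_decorrelated {G E T : Type*} [NormedAddCommGroup E]
    [InnerProductSpace ℂ E] (U : G → E →ₗᵢ[ℂ] E) {o : E} (ho : ‖o‖ = 1) (hUo : ∀ g, U g o = o)
    (e : T → E) (he : (Submodule.span ℂ (Set.range e)).topologicalClosure = ⊤)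
    (hmix : ∀ (F : Finset T) (ε : ℝ), 0 < ε → ∃ g, ∀ t ∈ F, ∀ u ∈ F,
      ‖inner ℂ (U g (e t)) (e u) - inner ℂ (e t) o * inner ℂ o (e u)‖ < ε)
    {f : E} (hf : ∀ g, U g f = f) (hfo : inner ℂ o f = 0) : f = 0 := by
  by_contra hne
  have hfpos : 0 < ‖f‖ := norm_pos_iff.2 hne
  have hoo : inner ℂ o o = 1 := by
    rw [inner_self_eq_norm_sq_to_K, ho]; simp
  obtain ⟨h, hh, hfh⟩ := Metric.mem_closure_iff.1 (show f ∈ closure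
    (Submodule.span ℂ (Set.range e) : Set E) by
      rw [← Submodule.topologicalClosure_coe, he]; trivial) (‖f‖ / 4) (by positivity)
  obtain ⟨c, rfl⟩ := Finsupp.mem_span_range_iff_exists_finsupp.1 hh
  -- Removing the `o`-component turns decorrelation into `⟪U g e', e'⟫ ≈ 0`, and does not spoil the
  -- approximation of `f` because `f ⊥ o`.
  set e' : T → E := fun t => e t - inner ℂ o (e t) • o with he'
  set h' : E := ∑ t ∈ c.support, c t • e' t with hh'
  have hh'eq : h' = c.sum (fun t a => a • e t) - inner ℂ o (c.sum fun t a => a • e t) • o := by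
    rw [hh', Finsupp.sum, inner_sum, Finset.sum_smul, ← Finset.sum_sub_distrib]
    refine Finset.sum_congr rfl fun t _ => ?_
    rw [he', smul_sub, inner_smul_right, mul_smul]
  have hdist : ‖f - h'‖ ≤ ‖f‖ / 4 := by
    set w := f - c.sum (fun t a => a • e t) with hw
    have hwe : f - h' = w - inner ℂ o w • o := by
      rw [hw, inner_sub_right, hfo, hh'eq]
      module
    have horth : inner ℂ (w - inner ℂ o w • o) (inner ℂ o w • o) = 0 := by
      rw [inner_smul_right, inner_sub_left, inner_smul_left, hoo, inner_conj_symm]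
      simp
    have hpyth := norm_add_sq_eq_norm_sq_add_norm_sq_of_inner_eq_zero _ _ horth
    rw [sub_add_cancel] at hpyth
    have : ‖f - h'‖ ≤ ‖w‖ := by
      rw [hwe]
      nlinarith [norm_nonneg w, norm_nonneg (w - inner ℂ o w • o),
        mul_self_nonneg ‖inner ℂ o w • o‖]
    rw [dist_eq_norm] at hfh
    linarith
  have hnh' : ‖h'‖ ≤ 5 / 4 * ‖f‖ := by
    have := norm_sub_norm_le h' f
    rw [norm_sub_rev] at this
    linarith
  set M : ℝ := ∑ t ∈ c.support, ∑ u ∈ c.support, ‖c t‖ * ‖c u‖ with hM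
  have hM0 : 0 ≤ M := Finset.sum_nonneg fun _ _ => Finset.sum_nonneg fun _ _ => by positivity
  -- `M` is the total weight of the double sum for `⟪U g h', h'⟫`, so this tolerance bounds it by
  -- `‖f‖ ^ 2 / 4`; the `+ 1` keeps the denominator positive.
  obtain ⟨g, hg⟩ := hmix c.support (‖f‖ ^ 2 / (4 * (M + 1))) (by positivity)
  have hcorr : ∀ t u, inner ℂ (U g (e' t)) (e' u)
      = inner ℂ (U g (e t)) (e u) - inner ℂ (e t) o * inner ℂ o (e u) := by
    intro t u
    have h1 : inner ℂ (U g (e t)) o = inner ℂ (e t) o := by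
      conv_lhs => rw [← hUo g]
      exact (U g).inner_map_map _ _
    rw [he', map_sub, map_smul, hUo, inner_sub_left, inner_sub_right, inner_sub_right,
      inner_smul_left, inner_smul_right, inner_smul_right, inner_smul_left, h1, hoo,
      inner_conj_symm]
    ring
  have hbound : ‖inner ℂ (U g h') h'‖ ≤ ‖f‖ ^ 2 / 4 := by
    have hexp : inner ℂ (U g h') h' = ∑ t ∈ c.support, ∑ u ∈ c.support,
        (starRingEnd ℂ (c t)) * (c u * inner ℂ (U g (e' t)) (e' u)) := by
      rw [hh', map_sum, sum_inner]
      refine Finset.sum_congr rfl fun t _ => ?_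
      rw [inner_sum]
      refine Finset.sum_congr rfl fun u _ => ?_
      rw [map_smul, inner_smul_left, inner_smul_right]
    rw [hexp]
    calc _ ≤ ∑ t ∈ c.support, ∑ u ∈ c.support,
          (‖c t‖ * ‖c u‖) * (‖f‖ ^ 2 / (4 * (M + 1))) := by
          refine (norm_sum_le _ _).trans (Finset.sum_le_sum fun t ht => ?_)
          refine (norm_sum_le _ _).trans (Finset.sum_le_sum fun u hu => ?_)
          rw [norm_mul, norm_mul, RCLike.norm_conj, hcorr, mul_assoc]
          have := (hg t ht u hu).le
          gcongr
      _ = M * (‖f‖ ^ 2 / (4 * (M + 1))) := by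
          rw [hM, Finset.sum_mul]
          exact Finset.sum_congr rfl fun _ _ => by rw [Finset.sum_mul]
      _ = (M / (M + 1)) * (‖f‖ ^ 2 / 4) := by field_simp
      _ ≤ 1 * (‖f‖ ^ 2 / 4) := by
          gcongr
          rw [div_le_one (by linarith)]
          linarith
      _ = _ := one_mul _
  have hff : (inner ℂ f f : ℂ) = inner ℂ (U g h') h' + inner ℂ (U g h') (f - h')
      + inner ℂ (U g (f - h')) f := by
    rw [map_sub, inner_sub_left, inner_sub_right, hf]
    ring
  -- The coefficients sum to `1/4 + 5/16 + 1/4 = 13/16 < 1`, which is the contradiction.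
  have hle : ‖f‖ ^ 2 ≤ ‖f‖ ^ 2 / 4 + (5 / 4 * ‖f‖) * (‖f‖ / 4) + (‖f‖ / 4) * ‖f‖ := by
    have h1 : ‖(inner ℂ f f : ℂ)‖ = ‖f‖ ^ 2 := by
      rw [inner_self_eq_norm_sq_to_K]; simp
    refine h1.symm.le.trans ?_
    rw [hff]
    refine (norm_add₃_le).trans ?_
    refine add_le_add (add_le_add hbound ?_) ?_
    · refine (norm_inner_le_norm _ _).trans ?_
      rw [(U g).norm_map]
      gcongr
    · refine (norm_inner_le_norm _ _).trans ?_
      rw [(U g).norm_map]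
      gcongr
  nlinarith

/-! ### Totality of exponentials of linear functionals in `L²`. -/

section Exponentials

open Complex

theorem memLp_exp_evalComb {J : Type*} (ν : Measure (J → ℝ)) [IsProbabilityMeasure ν]
    (t : J →₀ ℝ) : MemLp (fun ω => cexp (evalComb t ω * I)) 2 ν := by
  refine MemLp.of_bound (Measurable.aestronglyMeasurable (by fun_prop)) 1 (.of_forall fun ω => ?_)
  rw [Complex.norm_exp_ofReal_mul_I]

/-- The exponential of a linear functional, as an element of `L²`. -/
noncomputable def expLp {J : Type*} (ν : Measure (J → ℝ)) [IsProbabilityMeasure ν]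
    (t : J →₀ ℝ) : Lp ℂ 2 ν := (memLp_exp_evalComb ν t).toLp

theorem inner_expLp {J : Type*} (ν : Measure (J → ℝ)) [IsProbabilityMeasure ν] (t u : J →₀ ℝ) :
    inner ℂ (expLp ν t) (expLp ν u) = ∫ ω, cexp (evalComb (u - t) ω * I) ∂ν := by
  rw [L2.inner_def]
  refine integral_congr_ae ?_
  filter_upwards [(memLp_exp_evalComb ν t).coeFn_toLp, (memLp_exp_evalComb ν u).coeFn_toLp]
    with ω h1 h2
  simp only [expLp]
  rw [h1, h2, RCLike.inner_apply, ← Complex.exp_conj, ← Complex.exp_add, evalComb_sub]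
  congr 1
  simp
  ring

/-- The positive and negative parts of `u` are densities of two finite measures with the same
characteristic functional, hence of the same measure. -/
theorem ae_eq_zero_of_integral_exp_evalComb {J : Type*} (ν : Measure (J → ℝ))
    [IsProbabilityMeasure ν] {u : (J → ℝ) → ℝ} (hu : Integrable u ν)
    (h : ∀ t : J →₀ ℝ, ∫ ω, (u ω : ℂ) * cexp (evalComb t ω * I) ∂ν = 0) : u =ᵐ[ν] 0 := by
  have hp := hu.aemeasurable.ennreal_ofReal
  have hn := hu.neg.aemeasurable.ennreal_ofReal
  have hpf : ∫⁻ ω, ENNReal.ofReal (u ω) ∂ν ≠ ∞ := hu.lintegral_lt_top.ne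
  have hnf : ∫⁻ ω, ENNReal.ofReal ((-u) ω) ∂ν ≠ ∞ := hu.neg.lintegral_lt_top.ne
  have : IsFiniteMeasure (ν.withDensity fun ω => ENNReal.ofReal (u ω)) :=
    isFiniteMeasure_withDensity hpf
  have : IsFiniteMeasure (ν.withDensity fun ω => ENNReal.ofReal ((-u) ω)) :=
    isFiniteMeasure_withDensity hnf
  have heq : (ν.withDensity fun ω => ENNReal.ofReal (u ω))
      = ν.withDensity fun ω => ENNReal.ofReal ((-u) ω) := by
    refine ext_of_integral_exp_evalComb fun t => ?_
    rw [integral_withDensity_eq_integral_toReal_smul₀ hp (.of_forall fun _ => ENNReal.ofReal_lt_top),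
      integral_withDensity_eq_integral_toReal_smul₀ hn (.of_forall fun _ => ENNReal.ofReal_lt_top),
      ← sub_eq_zero]
    have hbd : ∀ w : (J → ℝ) → ℝ, Integrable w ν →
        Integrable (fun ω => w ω • cexp (evalComb t ω * I)) ν := by
      intro w hw
      refine hw.norm.mono' (hw.aestronglyMeasurable.smul
        (Measurable.aestronglyMeasurable (by fun_prop))) (.of_forall fun ω => ?_)
      rw [norm_smul, Complex.norm_exp_ofReal_mul_I, mul_one]
    rw [← integral_sub (hbd _ (integrable_toReal_of_lintegral_ne_top hp hpf))
      (hbd _ (integrable_toReal_of_lintegral_ne_top hn hnf)), ← h t]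
    refine integral_congr_ae (.of_forall fun ω => ?_)
    simp only [Pi.neg_apply]
    rw [← sub_smul, Complex.real_smul]
    congr 2
    rcases le_total 0 (u ω) with h0 | h0
    · rw [ENNReal.toReal_ofReal h0, ENNReal.ofReal_of_nonpos (by linarith)]; simp
    · rw [ENNReal.toReal_ofReal (r := -u ω) (by linarith), ENNReal.ofReal_of_nonpos h0]; simp
  rw [withDensity_eq_iff hp hn hpf] at heq
  filter_upwards [heq] with ω hω
  rcases le_total 0 (u ω) with h0 | h0
  · rw [Pi.neg_apply, ENNReal.ofReal_of_nonpos (p := -u ω) (by linarith),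
      ENNReal.ofReal_eq_zero] at hω
    exact le_antisymm hω h0
  · rw [ENNReal.ofReal_of_nonpos h0, eq_comm, ENNReal.ofReal_eq_zero, Pi.neg_apply] at hω
    exact le_antisymm h0 (neg_nonpos.1 hω)

/-- A function orthogonal to all exponentials has a conjugate with the same property (replace `t` by
`-t`), so its real and imaginary parts vanish by the uniqueness lemma. -/
theorem topologicalClosure_span_expLp {J : Type*} (ν : Measure (J → ℝ))
    [IsProbabilityMeasure ν] :
    (Submodule.span ℂ (Set.range (expLp ν))).topologicalClosure = ⊤ := by
  rw [Submodule.topologicalClosure_eq_top_iff, Submodule.eq_bot_iff]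
  intro f hf
  rw [Submodule.mem_orthogonal] at hf
  have hfi : Integrable f ν := (Lp.memLp f).integrable (by norm_num)
  have hfe : ∀ t : J →₀ ℝ, Integrable (fun ω => f ω * cexp (evalComb t ω * I)) ν := by
    intro t
    refine hfi.norm.mono' (hfi.aestronglyMeasurable.mul
      (Measurable.aestronglyMeasurable (by fun_prop))) (.of_forall fun ω => ?_)
    rw [norm_mul, Complex.norm_exp_ofReal_mul_I, mul_one]
  have h0 : ∀ t : J →₀ ℝ, ∫ ω, f ω * cexp (evalComb t ω * I) ∂ν = 0 := by
    intro t
    rw [← hf (expLp ν (-t)) (Submodule.subset_span ⟨_, rfl⟩), L2.inner_def]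
    refine integral_congr_ae ?_
    filter_upwards [(memLp_exp_evalComb ν (-t)).coeFn_toLp] with ω h1
    simp only [expLp]
    rw [h1, RCLike.inner_apply, ← Complex.exp_conj, evalComb_neg]
    simp
  have h0' : ∀ t : J →₀ ℝ, ∫ ω, starRingEnd ℂ (f ω) * cexp (evalComb t ω * I) ∂ν = 0 := by
    intro t
    have := congrArg (starRingEnd ℂ) (h0 (-t))
    rw [← integral_conj, map_zero] at this
    rw [← this]
    refine integral_congr_ae (.of_forall fun ω => ?_)
    simp only [map_mul, ← Complex.exp_conj, evalComb_neg]
    simp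
  have hfe' : ∀ t : J →₀ ℝ,
      Integrable (fun ω => starRingEnd ℂ (f ω) * cexp (evalComb t ω * I)) ν := by
    intro t
    refine hfi.norm.mono' ((Complex.continuous_conj.comp_aestronglyMeasurable
      hfi.aestronglyMeasurable).mul
      (Measurable.aestronglyMeasurable (by fun_prop))) (.of_forall fun ω => ?_)
    rw [norm_mul, Complex.norm_exp_ofReal_mul_I, mul_one, RCLike.norm_conj]
  have hre := ae_eq_zero_of_integral_exp_evalComb ν hfi.re fun t => by
    have e : ∀ ω, ((RCLike.re (f ω) : ℝ) : ℂ) * cexp (evalComb t ω * I)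
        = (1 / 2 : ℂ) * (f ω * cexp (evalComb t ω * I)
          + starRingEnd ℂ (f ω) * cexp (evalComb t ω * I)) := by
      intro ω
      rw [← add_mul, Complex.add_conj]
      simp only [RCLike.re_to_complex]
      push_cast
      ring
    simp_rw [e]
    rw [integral_const_mul, integral_add (hfe t) (hfe' t), h0, h0']
    simp
  have him := ae_eq_zero_of_integral_exp_evalComb ν hfi.im fun t => by
    have e : ∀ ω, ((RCLike.im (f ω) : ℝ) : ℂ) * cexp (evalComb t ω * I)
        = (1 / (2 * I) : ℂ) * (f ω * cexp (evalComb t ω * I)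
          - starRingEnd ℂ (f ω) * cexp (evalComb t ω * I)) := by
      intro ω
      rw [← sub_mul, Complex.sub_conj]
      simp only [RCLike.im_to_complex]
      field_simp
      push_cast
      ring
    simp_rw [e]
    rw [integral_const_mul, integral_sub (hfe t) (hfe' t), h0, h0']
    simp
  refine (Lp.eq_zero_iff_ae_eq_zero).2 ?_
  filter_upwards [hre, him] with ω h1 h2
  exact Complex.ext h1 h2

end Exponentials

/-! ### The isonormal process indexed by a real Hilbert space. -/

section Isonormal

open Complex ProbabilityTheory
open scoped RealInnerProductSpace NNReal

variable {H : Type v} [NormedAddCommGroup H] [InnerProductSpace ℝ H]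

/-- The vector `∑ t x • x`. -/
noncomputable def linComb (t : H →₀ ℝ) : H := Finsupp.linearCombination ℝ (id : H → H) t

theorem linComb_sub (t u : H →₀ ℝ) : linComb (t - u) = linComb t - linComb u := map_sub _ _ _

theorem linComb_smul (c : ℝ) (t : H →₀ ℝ) : linComb (c • t) = c • linComb t := map_smul _ _ _

@[simp]
theorem linComb_zero : linComb (0 : H →₀ ℝ) = 0 := map_zero _

@[simp]
theorem linComb_single (x : H) (c : ℝ) : linComb (Finsupp.single x c) = c • x := by
  simp [linComb]

theorem linComb_mapDomain (T : H →ₗ[ℝ] H) (t : H →₀ ℝ) :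
    linComb (t.mapDomain T) = T (linComb t) := by
  unfold linComb
  rw [Finsupp.linearCombination_mapDomain, Finsupp.apply_linearCombination]
  rfl

/-- The law `ν` on the space of all real functions on `H` makes the evaluations a centered Gaussian
process with covariance the inner product. -/
structure IsIsonormal (ν : Measure (H → ℝ)) : Prop where
  isProbabilityMeasure : IsProbabilityMeasure ν
  integral_exp : ∀ t : H →₀ ℝ, ∫ ω, cexp (evalComb t ω * I) ∂ν
    = cexp (-((‖linComb t‖ ^ 2 : ℝ) : ℂ) / 2)

-- Push `P` forward by `ω ↦ (x ↦ T x ω)`. Linearity in `x` holds only almost everywhere, which is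
-- enough as each `t` has finite support. On the space of all functions `H → ℝ` the group acts at
-- every point, not merely up to null sets.
variable (H) in
theorem exists_isIsonormal [CompleteSpace H] : ∃ ν : Measure (H → ℝ), IsIsonormal ν := by
  obtain ⟨Ω, _, P, _, T, hT⟩ := exists_gaussian_isometry H
  have hΦ : Measurable fun (ω : Ω) (x : H) => T x ω :=
    measurable_pi_iff.2 fun x => (Lp.stronglyMeasurable (T x)).measurable
  refine ⟨P.map fun ω x => T x ω, Measure.isProbabilityMeasure_map hΦ.aemeasurable, fun t => ?_⟩
  rw [integral_map hΦ.aemeasurable (Measurable.aestronglyMeasurable (by fun_prop)), ← hT]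
  refine integral_congr_ae ?_
  have hae : (T (linComb t) : Ω → ℝ) =ᵐ[P] fun ω => evalComb t fun x => T x ω := by
    have e : T (linComb t) = ∑ x ∈ t.support, t x • T x := by
      rw [linComb, Finsupp.linearCombination_apply, Finsupp.sum, map_sum]
      exact Finset.sum_congr rfl fun x _ => by rw [map_smul, id]
    rw [e]
    refine (Lp.coeFn_finsetSum _ _).trans ?_
    have hall : ∀ᵐ ω ∂P, ∀ x ∈ t.support, (t x • T x : Lp ℝ 2 P) ω = t x * T x ω := by
      refine (Filter.eventually_all_finset _).2 fun x _ => ?_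
      filter_upwards [Lp.coeFn_smul (t x) (T x)] with ω h1
      rw [h1, Pi.smul_apply, smul_eq_mul]
    filter_upwards [hall] with ω hω
    rw [Finset.sum_apply]
    exact Finset.sum_congr rfl hω
  filter_upwards [hae] with ω hω
  rw [hω]

theorem IsIsonormal.map_evalComb {ν : Measure (H → ℝ)} (hν : IsIsonormal ν) (t : H →₀ ℝ) :
    ν.map (evalComb t) = gaussianReal 0 (‖linComb t‖₊ ^ 2) := by
  have := hν.isProbabilityMeasure
  have := Measure.isProbabilityMeasure_map (μ := ν) (measurable_evalComb t).aemeasurable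
  refine Measure.ext_of_charFun (funext fun ξ => ?_)
  rw [charFun_apply_real, charFun_gaussianReal, integral_map (by fun_prop)
    (Measurable.aestronglyMeasurable (by fun_prop))]
  have h := hν.integral_exp (ξ • t)
  simp only [evalComb_smul, linComb_smul, norm_smul, mul_pow, Real.norm_eq_abs, sq_abs] at h
  push_cast at h
  rw [h]
  congr 1
  push_cast
  ring

theorem IsIsonormal.memLp_evalComb {ν : Measure (H → ℝ)} (hν : IsIsonormal ν) (t : H →₀ ℝ) :
    MemLp (evalComb t) 2 ν := by
  have h : MemLp id 2 (ν.map (evalComb t)) := by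
    rw [hν.map_evalComb]
    exact memLp_id_gaussianReal 2
  exact (memLp_map_measure_iff h.aestronglyMeasurable (measurable_evalComb t).aemeasurable).1 h

theorem IsIsonormal.integral_evalComb {ν : Measure (H → ℝ)} (hν : IsIsonormal ν) (t : H →₀ ℝ) :
    ∫ ω, evalComb t ω ∂ν = 0 := by
  have h := integral_map (μ := ν) (measurable_evalComb t).aemeasurable (f := fun x : ℝ => x)
    measurable_id.aestronglyMeasurable
  rw [← h, hν.map_evalComb, integral_id_gaussianReal]

theorem IsIsonormal.integral_evalComb_sq {ν : Measure (H → ℝ)} (hν : IsIsonormal ν)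
    (t : H →₀ ℝ) : ∫ ω, evalComb t ω ^ 2 ∂ν = ‖linComb t‖ ^ 2 := by
  have h := integral_map (μ := ν) (measurable_evalComb t).aemeasurable (f := fun x : ℝ => x ^ 2)
    (Measurable.aestronglyMeasurable (by fun_prop))
  rw [← h, hν.map_evalComb]
  have hv := variance_fun_id_gaussianReal (μ := 0) (v := ‖linComb t‖₊ ^ 2)
  rw [variance_eq_integral measurable_id'.aemeasurable, integral_id_gaussianReal] at hv
  simpa using hv

end Isonormal

/-! ### The Gaussian action of an orthogonal representation. -/

namespace OrthogonalRep

open Complex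
open scoped RealInnerProductSpace NNReal

variable {G : Type u} [Group G] [TopologicalSpace G]
  {H : Type v} [NormedAddCommGroup H] [InnerProductSpace ℝ H]

/-- The action of `G` on the real functions on `H` induced by `π`. -/
@[reducible]
def functionAction (π : OrthogonalRep G H) : MulAction G (H → ℝ) where
  smul g ω := fun x => ω (π.toHom g⁻¹ x)
  one_smul ω := funext fun x => by
    change ω (π.toHom 1⁻¹ x) = ω x
    rw [inv_one, one_apply]
  mul_smul g h ω := funext fun x => by
    change ω (π.toHom (g * h)⁻¹ x) = ω (π.toHom h⁻¹ (π.toHom g⁻¹ x))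
    rw [mul_inv_rev, mul_apply]

theorem linComb_mapDomain_apply (π : OrthogonalRep G H) (t : H →₀ ℝ) (g : G) :
    linComb (t.mapDomain (π.toHom g)) = π.toHom g (linComb t) :=
  linComb_mapDomain (π.toHom g).toLinearEquiv.toLinearMap t

section FunctionAction

variable [MulAction G (H → ℝ)] {π : OrthogonalRep G H}

theorem measurableConstSMul_of_functionAction
    (hact : ∀ (g : G) (ω : H → ℝ) (x : H), (g • ω) x = ω (π.toHom g⁻¹ x)) :
    MeasurableConstSMul G (H → ℝ) :=
  ⟨fun g => measurable_pi_iff.2 fun x => by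
    simp_rw [hact]
    exact measurable_pi_apply _⟩

theorem evalComb_inv_smul
    (hact : ∀ (g : G) (ω : H → ℝ) (x : H), (g • ω) x = ω (π.toHom g⁻¹ x))
    (t : H →₀ ℝ) (g : G) (ω : H → ℝ) :
    evalComb t (g⁻¹ • ω) = evalComb (t.mapDomain (π.toHom g)) ω := by
  unfold evalComb
  rw [Finsupp.sum_mapDomain_index (by simp) (by intros; ring)]
  refine Finsupp.sum_congr fun x _ => ?_
  rw [hact, inv_inv]

/-- The characteristic functional depends on `t` only through `‖linComb t‖`, which `π` preserves. -/
theorem smulInvariantMeasure_of_isIsonormal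
    (hact : ∀ (g : G) (ω : H → ℝ) (x : H), (g • ω) x = ω (π.toHom g⁻¹ x))
    {ν : Measure (H → ℝ)}
    (hν : IsIsonormal ν) : SMulInvariantMeasure G (H → ℝ) ν := by
  have := measurableConstSMul_of_functionAction hact
  have := hν.isProbabilityMeasure
  refine ((smulInvariantMeasure_tfae G ν).out 0 5).2 fun g => ?_
  have hm : Measurable fun ω : (H → ℝ) => g • ω := measurable_const_smul g
  have : IsProbabilityMeasure (ν.map fun ω : (H → ℝ) => g • ω) :=
    Measure.isProbabilityMeasure_map hm.aemeasurable
  refine ext_of_integral_exp_evalComb fun t => ?_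
  rw [integral_map hm.aemeasurable (Measurable.aestronglyMeasurable (by fun_prop)),
    hν.integral_exp]
  have e : ∀ ω : (H → ℝ), evalComb t (g • ω)
      = evalComb (t.mapDomain (π.toHom g⁻¹)) ω := by
    intro ω
    rw [← evalComb_inv_smul hact, inv_inv]
  simp_rw [e]
  rw [hν.integral_exp, linComb_mapDomain_apply, LinearIsometryEquiv.norm_map]

theorem koopman_expLp
    (hact : ∀ (g : G) (ω : H → ℝ) (x : H), (g • ω) x = ω (π.toHom g⁻¹ x))
    {ν : Measure (H → ℝ)} [MeasurableConstSMul G (H → ℝ)] [IsProbabilityMeasure ν]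
    [SMulInvariantMeasure G (H → ℝ) ν] (g : G) (t : H →₀ ℝ) :
    koopman ν g (expLp ν t) = expLp ν (t.mapDomain (π.toHom g)) := by
  refine (koopman_toLp ν g (memLp_exp_evalComb ν t)).trans (MemLp.toLp_congr _ _ ?_)
  refine .of_forall fun ω => ?_
  simp only [Function.comp_apply, evalComb_inv_smul hact]

/-- The correlation of two exponentials is the product of their means times `exp ⟪π g x, y⟫`, so
weak mixing decorrelates this total family and rules out invariant vectors of mean zero. Continuity
is also checked on exponentials, whose distances are explicit in `‖linComb u - linComb t‖`. -/
theorem isErgodicAction_of_isIsonormal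
    (hact : ∀ (g : G) (ω : H → ℝ) (x : H), (g • ω) x = ω (π.toHom g⁻¹ x))
    {ν : Measure (H → ℝ)}
    (hν : IsIsonormal ν)
    (hmix : ∀ (F : Finset H) (ε : ℝ), 0 < ε → ∃ g, ∀ x ∈ F, ∀ y ∈ F, |⟪π.toHom g x, y⟫| < ε) :
    IsErgodicAction G ν := by
  classical
  have := measurableConstSMul_of_functionAction hact
  have := hν.isProbabilityMeasure
  have := smulInvariantMeasure_of_isIsonormal hact hν
  have hinner : ∀ t u : H →₀ ℝ, inner ℂ (expLp ν t) (expLp ν u)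
      = ((Real.exp (-‖linComb u - linComb t‖ ^ 2 / 2) : ℝ) : ℂ) := by
    intro t u
    rw [inner_expLp, hν.integral_exp, linComb_sub]
    push_cast
    rfl
  have hnormsq : ∀ t : H →₀ ℝ, ‖expLp ν t‖ ^ 2 = 1 := by
    intro t
    have h1 := hinner t t
    rw [inner_self_eq_norm_sq_to_K] at h1
    simp only [sub_self, norm_zero, ne_eq, OfNat.ofNat_ne_zero, not_false_eq_true, zero_pow,
      neg_zero, zero_div, Real.exp_zero] at h1
    have h2 : ((‖expLp ν t‖ ^ 2 : ℝ) : ℂ) = 1 := by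
      push_cast
      exact h1
    exact Complex.ofReal_eq_one.1 h2
  have hone : Lp.const 2 ν (1 : ℂ) = expLp ν 0 := by
    refine (Lp.ext ?_)
    refine (Lp.coeFn_const (p := 2) (μ := ν) (1 : ℂ)).trans ?_
    refine Filter.EventuallyEq.trans ?_ (memLp_exp_evalComb ν 0).coeFn_toLp.symm
    exact .of_forall fun ω => by simp
  refine ⟨inferInstance, inferInstance, ?_, ?_⟩
  · refine ergodicSMul_of_koopman G ν fun f hf hf0 => ?_
    rw [← inner_const_one, hone] at hf0
    refine eq_zero_of_invariant_of_decorrelated (koopman (G := G) ν) (o := expLp ν 0)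
      ?_ ?_ (expLp ν) (topologicalClosure_span_expLp ν) ?_ hf hf0
    · exact (pow_eq_one_iff_of_nonneg (norm_nonneg _) two_ne_zero).1 (hnormsq 0)
    · intro g
      rw [koopman_expLp hact, Finsupp.mapDomain_zero]
    · intro F ε hε
      obtain ⟨δ, hδ, hexp⟩ := Metric.continuous_iff.1 Real.continuous_exp 0 ε hε
      obtain ⟨g, hg⟩ := hmix (F.image linComb) δ hδ
      refine ⟨g, fun t ht u hu => ?_⟩
      have hr := hg _ (Finset.mem_image_of_mem _ ht) _ (Finset.mem_image_of_mem _ hu)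
      rw [koopman_expLp hact, hinner, hinner, hinner, linComb_mapDomain_apply, linComb_zero, zero_sub,
        sub_zero, norm_neg, ← Complex.ofReal_mul, ← Complex.ofReal_sub, Complex.norm_real,
        Real.norm_eq_abs]
      have h1 : Real.exp (-‖linComb u - π.toHom g (linComb t)‖ ^ 2 / 2)
          = Real.exp (-‖linComb t‖ ^ 2 / 2) * Real.exp (-‖linComb u‖ ^ 2 / 2)
            * Real.exp ⟪π.toHom g (linComb t), linComb u⟫ := by
        rw [← Real.exp_add, ← Real.exp_add, norm_sub_sq_real, LinearIsometryEquiv.norm_map,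
          real_inner_comm]
        congr 1
        ring
      have h2 := hexp ⟪π.toHom g (linComb t), linComb u⟫ (by rwa [Real.dist_0_eq_abs])
      rw [Real.exp_zero, Real.dist_eq] at h2
      rw [h1, ← mul_sub_one, abs_mul]
      refine lt_of_le_of_lt (mul_le_of_le_one_left (abs_nonneg _) ?_) h2
      rw [← Real.exp_add, Real.abs_exp, Real.exp_le_one_iff]
      nlinarith [sq_nonneg ‖linComb t‖, sq_nonneg ‖linComb u‖]
  · intro f
    refine continuous_isometry_apply_of_total (koopman (G := G) ν)
      (topologicalClosure_span_expLp ν) ?_ f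
    rintro _ ⟨t, rfl⟩
    simp_rw [koopman_expLp hact]
    rw [continuous_iff_continuousAt]
    intro g₀
    rw [ContinuousAt, tendsto_iff_norm_sub_tendsto_zero]
    have hnorm : ∀ t u : H →₀ ℝ, ‖expLp ν t - expLp ν u‖
        = Real.sqrt (2 - 2 * Real.exp (-‖linComb u - linComb t‖ ^ 2 / 2)) := by
      intro t u
      have h1 := norm_sub_sq (𝕜 := ℂ) (expLp ν t) (expLp ν u)
      rw [hnormsq, hnormsq, hinner, RCLike.re_to_complex, Complex.ofReal_re] at h1
      rw [← Real.sqrt_sq (norm_nonneg (expLp ν t - expLp ν u)), h1]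
      congr 1
      ring
    simp_rw [hnorm, linComb_mapDomain_apply]
    have hc : Continuous fun g => Real.sqrt (2 - 2 * Real.exp
        (-‖π.toHom g₀ (linComb t) - π.toHom g (linComb t)‖ ^ 2 / 2)) := by
      have := π.continuous_orbit (linComb t)
      fun_prop
    have := hc.tendsto g₀
    simpa using this

end FunctionAction

/-- The Gaussian action of a weakly mixing representation with almost invariant vectors is ergodic
and not expanding. -/
theorem exists_nonexpanding_of_mixing [CompleteSpace H] (π : OrthogonalRep G H)
    (hmix : ∀ (F : Finset H) (ε : ℝ), 0 < ε → ∃ g, ∀ x ∈ F, ∀ y ∈ F, |⟪π.toHom g x, y⟫| < ε)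
    {S : Finset G} (hS : S.Nonempty) (hai : π.HasAlmostInvariantVectors S) :
    ∃ (_ : MulAction G (H → ℝ)) (ν : Measure (H → ℝ)), IsErgodicAction G ν ∧
      ¬ IsExpandingInMeasure (genSet (S : Set G)) ν := by
  obtain ⟨ν, hν⟩ := exists_isIsonormal H
  let _ := π.functionAction
  have hact : ∀ (g : G) (ω : H → ℝ) (x : H), (g • ω) x = ω (π.toHom g⁻¹ x) := fun _ _ _ => rfl
  have := measurableConstSMul_of_functionAction hact
  have := hν.isProbabilityMeasure
  have := smulInvariantMeasure_of_isIsonormal hact hν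
  refine ⟨inferInstance, ν, isErgodicAction_of_isIsonormal hact hν hmix, ?_⟩
  rintro ⟨α, hα, hexp⟩
  have hn : (0 : ℝ) < S.card := by exact_mod_cast hS.card_pos
  -- With this tolerance the right side of the Cheeger inequality is at most `α ^ 2 * ‖x‖ ^ 2 / 4`,
  -- below its left side.
  obtain ⟨x, hx0, hx⟩ := hai (α / (4 * S.card)) (by positivity)
  have hxpos : 0 < ‖x‖ := norm_pos_iff.2 hx0
  -- Evaluation at `x` is centred with `L²` norm `‖x‖`, and `s` displaces it by `‖π s x - x‖`.
  set t : H →₀ ℝ := Finsupp.single x 1 with ht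
  have key := hexp.sq_mul_integral_sq_le (ν := ν) hS hα (f := evalComb t) (measurable_evalComb t)
    (hν.memLp_evalComb t) (hν.integral_evalComb t)
  have h1 : ∫ ω : (H → ℝ), evalComb t ω ^ 2 ∂ν = ‖x‖ ^ 2 := by
    have := hν.integral_evalComb_sq t
    rw [ht, linComb_single, one_smul] at this
    exact this
  have h2 : ∀ s ∈ S, ∫ ω : (H → ℝ), (evalComb t (s⁻¹ • ω) - evalComb t ω) ^ 2 ∂ν
      ≤ (α / (4 * S.card) * ‖x‖) ^ 2 := by
    intro s hs
    simp_rw [evalComb_inv_smul hact, ← evalComb_sub]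
    have := hν.integral_evalComb_sq (t.mapDomain (π.toHom s) - t)
    rw [linComb_sub, linComb_mapDomain_apply, ht, linComb_single, one_smul] at this
    refine this.le.trans (pow_le_pow_left₀ (norm_nonneg _) (hx s hs) 2)
  have h3 := Finset.sum_le_card_nsmul S _ _ h2
  rw [nsmul_eq_mul] at h3
  have h4 := key.trans (mul_le_mul_of_nonneg_left h3 (by positivity))
  rw [h1] at h4
  have e : 4 * (S.card : ℝ) * (S.card * (α / (4 * S.card) * ‖x‖) ^ 2) = α ^ 2 * ‖x‖ ^ 2 / 4 := by
    field_simp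
  rw [e] at h4
  have : 0 < α ^ 2 * ‖x‖ ^ 2 := by positivity
  linarith

end OrthogonalRep

/-! ### The orthogonal group in the strong operator topology. -/

section StrongTopology

variable {H : Type v} [NormedAddCommGroup H] [InnerProductSpace ℝ H]

/-- The strong operator topology on the orthogonal group. -/
instance strongTopology : TopologicalSpace (H ≃ₗᵢ[ℝ] H) :=
  TopologicalSpace.induced (fun U => (U : H → H)) inferInstance

theorem continuous_orthogonal_coe : Continuous fun (U : H ≃ₗᵢ[ℝ] H) => (U : H → H) :=
  continuous_induced_dom

theorem continuous_orthogonal_apply (x : H) : Continuous fun (U : H ≃ₗᵢ[ℝ] H) => U x :=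
  (continuous_apply x).comp continuous_orthogonal_coe

theorem continuous_orthogonal_iff {T : Type*} [TopologicalSpace T] {f : T → (H ≃ₗᵢ[ℝ] H)} :
    Continuous f ↔ ∀ x, Continuous fun t => f t x := by
  rw [continuous_induced_rng, continuous_pi_iff]
  rfl

theorem orthogonal_inv_apply_apply (U : H ≃ₗᵢ[ℝ] H) (x : H) : U⁻¹ (U x) = x :=
  U.symm_apply_apply x

theorem orthogonal_apply_inv_apply (U : H ≃ₗᵢ[ℝ] H) (x : H) : U (U⁻¹ x) = x :=
  U.apply_symm_apply x

instance orthogonal_isTopologicalGroup : IsTopologicalGroup (H ≃ₗᵢ[ℝ] H) where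
  continuous_mul := by
    refine continuous_orthogonal_iff.2 fun x => continuous_iff_continuousAt.2 fun ⟨U, V⟩ => ?_
    have h1 : Continuous fun p : (H ≃ₗᵢ[ℝ] H) × (H ≃ₗᵢ[ℝ] H) =>
        dist (p.2 x) (V x) + dist (p.1 (V x)) (U (V x)) :=
      (((continuous_orthogonal_apply x).comp continuous_snd).dist continuous_const).add
        (((continuous_orthogonal_apply (V x)).comp continuous_fst).dist continuous_const)
    refine tendsto_iff_dist_tendsto_zero.2 (squeeze_zero (fun _ => dist_nonneg) (fun p => ?_)
      (by simpa using h1.tendsto (U, V)))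
    change dist (p.1 (p.2 x)) (U (V x)) ≤ _
    refine (dist_triangle _ (p.1 (V x)) _).trans ?_
    rw [p.1.dist_map]
  continuous_inv := by
    refine continuous_orthogonal_iff.2 fun x => continuous_iff_continuousAt.2 fun U => ?_
    have h1 : Continuous fun V : H ≃ₗᵢ[ℝ] H => dist x (V (U⁻¹ x)) :=
      continuous_const.dist (continuous_orthogonal_apply _)
    refine tendsto_iff_dist_tendsto_zero.2 (squeeze_zero (fun _ => dist_nonneg) (fun V => ?_)
      (by simpa [orthogonal_apply_inv_apply] using h1.tendsto U))
    change dist (V⁻¹ x) (U⁻¹ x) ≤ dist x (V (U⁻¹ x))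
    rw [← V.dist_map, orthogonal_apply_inv_apply]

/-- A closed subgroup of the orthogonal group all of whose orbits are relatively compact is
compact. -/
theorem isCompact_of_isClosed_of_orbits {K : Subgroup (H ≃ₗᵢ[ℝ] H)}
    (hK : IsClosed (K : Set (H ≃ₗᵢ[ℝ] H))) (C : H → Set H) (hC : ∀ x, IsCompact (C x))
    (hKC : ∀ U ∈ K, ∀ x, U x ∈ C x) : IsCompact (K : Set (H ≃ₗᵢ[ℝ] H)) := by
  rw [isCompact_iff_ultrafilter_le_nhds]
  intro F hF
  have hFK : ∀ᶠ U in (F : Filter _), U ∈ K := hF (Filter.mem_principal_self _)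
  have ha : ∀ x, ∃ y, Filter.Tendsto (fun U : H ≃ₗᵢ[ℝ] H => U x) F (nhds y) := by
    intro x
    obtain ⟨y, -, hy⟩ := isCompact_iff_ultrafilter_le_nhds.1 (hC x)
      (F.map fun U => U x) (by
        rw [Filter.le_principal_iff]
        exact hFK.mono fun U hU => hKC U hU x)
    exact ⟨y, hy⟩
  -- Inverses are followed along the same ultrafilter because a pointwise limit of surjective
  -- isometries need not be surjective.
  have hb : ∀ x, ∃ y, Filter.Tendsto (fun U : H ≃ₗᵢ[ℝ] H => U⁻¹ x) F (nhds y) := by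
    intro x
    obtain ⟨y, -, hy⟩ := isCompact_iff_ultrafilter_le_nhds.1 (hC x)
      (F.map fun U => U⁻¹ x) (by
        rw [Filter.le_principal_iff]
        exact hFK.mono fun U hU => hKC U⁻¹ (K.inv_mem hU) x)
    exact ⟨y, hy⟩
  choose a ha using ha
  choose b hb using hb
  have hab : ∀ x, a (b x) = x := by
    intro x
    refine tendsto_nhds_unique (ha (b x)) (tendsto_iff_dist_tendsto_zero.2 ?_)
    refine (tendsto_iff_dist_tendsto_zero.1 (hb x)).congr fun U => ?_
    rw [← U.dist_map, orthogonal_apply_inv_apply, dist_comm]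
  have hba : ∀ x, b (a x) = x := by
    intro x
    refine tendsto_nhds_unique (hb (a x)) (tendsto_iff_dist_tendsto_zero.2 ?_)
    refine (tendsto_iff_dist_tendsto_zero.1 (ha x)).congr fun U => ?_
    rw [← (U⁻¹).dist_map, orthogonal_inv_apply_apply, dist_comm]
  let V : H ≃ₗᵢ[ℝ] H :=
    { toFun := a
      invFun := b
      left_inv := hba
      right_inv := hab
      map_add' := fun x y => tendsto_nhds_unique (ha (x + y)) (by
        simpa only [map_add] using (ha x).add (ha y))
      map_smul' := fun c x => tendsto_nhds_unique (ha (c • x)) (by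
        simpa only [map_smul] using! (ha x).const_smul c)
      norm_map' := fun x => tendsto_nhds_unique (ha x).norm (by
        simpa only [LinearIsometryEquiv.norm_map] using tendsto_const_nhds) }
  have hV : (F : Filter _) ≤ nhds V := by
    rw [nhds_induced, ← Filter.tendsto_iff_comap, tendsto_pi_nhds]
    exact ha
  exact ⟨V, hK.mem_of_tendsto hV hFK, hV⟩

end StrongTopology

/-- Every compact set is within `η` of some finite-dimensional subspace, on which the norm is
computed by an orthonormal basis. -/
theorem exists_orthonormal_approx {H : Type v} [NormedAddCommGroup H] [InnerProductSpace ℝ H]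
    {C : Set H} (hC : TotallyBounded C) {η : ℝ} (hη : 0 < η) :
    ∃ (n : ℕ) (w : Fin n → H), Orthonormal ℝ w ∧
      ∀ c ∈ C, ‖c‖ ^ 2 - η ^ 2 ≤ ∑ i, inner ℝ (w i) c ^ 2 := by
  obtain ⟨t, ht, hcov⟩ := Metric.totallyBounded_iff.1 hC η hη
  set W : Submodule ℝ H := Submodule.span ℝ t with hW
  have : FiniteDimensional ℝ W := FiniteDimensional.span_of_finite ℝ ht
  set b := stdOrthonormalBasis ℝ W with hb
  refine ⟨_, fun i => (b i : H), b.orthonormal.comp_linearIsometry W.subtypeₗᵢ, fun c hc => ?_⟩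
  obtain ⟨a, ha, hca⟩ := Set.mem_iUnion₂.1 (hcov hc)
  have haW : a ∈ W := Submodule.subset_span ha
  have h1 : ∑ i, inner ℝ (b i : H) c ^ 2 = ‖W.starProjection c‖ ^ 2 := by
    have h2 := b.sum_sq_norm_inner_right (W.orthogonalProjectionOnto c)
    have h3 : ‖W.starProjection c‖ = ‖W.orthogonalProjectionOnto c‖ := rfl
    rw [h3, ← h2]
    refine Finset.sum_congr rfl fun i _ => ?_
    rw [Real.norm_eq_abs, sq_abs, Submodule.inner_orthogonalProjectionOnto_eq_of_mem_left]
  have h4 : ‖c - W.starProjection c‖ ≤ η := by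
    rw [W.starProjection_minimal]
    refine (ciInf_le ⟨0, by rintro _ ⟨x, rfl⟩; positivity⟩ (⟨a, haW⟩ : W)).trans ?_
    rw [Metric.mem_ball, dist_eq_norm] at hca
    exact hca.le
  have h5 := Submodule.norm_sq_eq_add_norm_sq_starProjection c W
  have h6 : Wᗮ.starProjection c = c - W.starProjection c := by
    rw [Submodule.starProjection_orthogonal]; rfl
  rw [h6] at h5
  rw [h1]
  nlinarith [norm_nonneg (c - W.starProjection c)]

/-! ### The compact case: translations on the closure of the image. -/

namespace OrthogonalRep

open scoped RealInnerProductSpace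

variable {G : Type u} [Group G] [TopologicalSpace G]
  {H : Type v} [NormedAddCommGroup H] [InnerProductSpace ℝ H]

/-- The closure of the image of `π` in the strong operator topology. -/
def closureRange (π : OrthogonalRep G H) : Subgroup (H ≃ₗᵢ[ℝ] H) :=
  π.toHom.range.topologicalClosure

/-- The representation, as a homomorphism into the closure of its image. -/
def toClosureRange (π : OrthogonalRep G H) : G →* π.closureRange :=
  π.toHom.codRestrict π.closureRange fun g => Subgroup.le_topologicalClosure _ ⟨g, rfl⟩

theorem continuous_toClosureRange (π : OrthogonalRep G H) : Continuous π.toClosureRange :=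
  (continuous_orthogonal_iff.2 π.continuous_orbit).subtype_mk _

theorem denseRange_toClosureRange (π : OrthogonalRep G H) : DenseRange π.toClosureRange := by
  intro k
  have hk : (k : H ≃ₗᵢ[ℝ] H) ∈ closure (π.toHom.range : Set (H ≃ₗᵢ[ℝ] H)) := k.2
  rw [closure_subtype]
  convert hk using 2
  ext U
  constructor
  · rintro ⟨_, ⟨g, rfl⟩, rfl⟩
    exact ⟨g, rfl⟩
  · rintro ⟨g, rfl⟩
    exact ⟨π.toClosureRange g, ⟨g, rfl⟩, rfl⟩

theorem compactSpace_closureRange [CompleteSpace H] (π : OrthogonalRep G H)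
    (htb : ∀ x, TotallyBounded (Set.range fun g => π.toHom g x)) :
    CompactSpace π.closureRange := by
  refine isCompact_iff_compactSpace.1 (isCompact_of_isClosed_of_orbits
    (Subgroup.isClosed_topologicalClosure _)
    (fun x => closure (Set.range fun g => π.toHom g x))
    (fun x => (htb x).closure.isCompact_of_isClosed isClosed_closure) fun U hU x => ?_)
  refine map_mem_closure (f := fun U : H ≃ₗᵢ[ℝ] H => U x) (continuous_orthogonal_apply x) hU ?_
  rintro _ ⟨g, rfl⟩
  exact ⟨g, rfl⟩

/-- Evaluation on a dense sequence is continuous and injective, hence embeds this compact group in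
`ℕ → H`. -/
theorem secondCountableTopology_closureRange [TopologicalSpace.SeparableSpace H]
    (π : OrthogonalRep G H) [CompactSpace π.closureRange] :
    SecondCountableTopology π.closureRange := by
  have : SecondCountableTopology H := UniformSpace.secondCountable_of_separable H
  obtain ⟨d, hd⟩ := TopologicalSpace.exists_dense_seq H
  have hc : Continuous fun (k : π.closureRange) (n : ℕ) => (k : H ≃ₗᵢ[ℝ] H) (d n) :=
    continuous_pi fun n => (continuous_orthogonal_apply (d n)).comp continuous_subtype_val
  refine (hc.isClosedEmbedding fun k l hkl => ?_).isEmbedding.secondCountableTopology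
  refine Subtype.ext (DFunLike.coe_injective ?_)
  refine (k : H ≃ₗᵢ[ℝ] H).continuous.ext_on hd (l : H ≃ₗᵢ[ℝ] H).continuous ?_
  rintro _ ⟨n, rfl⟩
  exact congrFun hkl n

/-- Left translation action of `G` on the closure of its image. -/
@[reducible]
def translationAction (π : OrthogonalRep G H) : MulAction G π.closureRange :=
  MulAction.compHom _ π.toClosureRange

section TranslationAction

variable {π : OrthogonalRep G H} [CompactSpace π.closureRange] [MeasurableSpace π.closureRange]
  [BorelSpace π.closureRange] [SecondCountableTopology π.closureRange]
  (ν : Measure π.closureRange) [ν.IsHaarMeasure] [IsProbabilityMeasure ν]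
  [MulAction G π.closureRange]

/-- Density of the image makes the action minimal, and ergodicity descends from the transitive
translations of the compact group to it. Continuity is that of the regular representation of the
compact group, composed with `π.toClosureRange`. -/
theorem isErgodicAction_translation
    (hact : ∀ (g : G) (k : π.closureRange), g • k = π.toClosureRange g * k) :
    IsErgodicAction G ν := by
  have : IsScalarTower G π.closureRange π.closureRange :=
    ⟨fun g k l => by simp only [hact, smul_eq_mul, mul_assoc]⟩
  have : MulAction.IsMinimal G π.closureRange := ⟨fun k => by
    have h := (Homeomorph.mulRight k).surjective.denseRange.comp
      π.denseRange_toClosureRange (Homeomorph.mulRight k).continuous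
    refine Dense.mono ?_ h
    rintro _ ⟨g, rfl⟩
    exact ⟨g, hact g k⟩⟩
  have hms : MeasurableConstSMul G π.closureRange := ⟨fun g => by
    simp_rw [hact]
    exact measurable_const_mul _⟩
  have herg : ErgodicSMul G π.closureRange ν :=
    ErgodicSMul.trans_isMinimal (M := G) ν π.closureRange
  refine ⟨inferInstance, hms, herg, fun f => ?_⟩
  have : Fact ((2 : ℝ≥0∞) ≠ ∞) := ⟨by norm_num⟩
  have hcont : Continuous fun k : π.closureRange => DomMulAct.mk k⁻¹ • f :=
    (DomMulAct.continuous_mk.comp continuous_inv).smul continuous_const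
  refine (hcont.comp π.continuous_toClosureRange).congr fun g => ?_
  refine Lp.ext ?_
  refine (DomMulAct.smul_Lp_ae_eq _ f).trans (Filter.EventuallyEq.trans (.of_forall fun k => ?_)
    (DomMulAct.smul_Lp_ae_eq (DomMulAct.mk g⁻¹) f).symm)
  simp [hact]

end TranslationAction

/-- If all orbits of `π` are relatively compact, then the translation action on the closure of the
image of `π` is ergodic and not expanding, provided `π` has almost invariant vectors. -/
theorem exists_nonexpanding_of_totallyBounded [CompleteSpace H]
    [TopologicalSpace.SeparableSpace H] (π : OrthogonalRep G H)
    (htb : ∀ x, TotallyBounded (Set.range fun g => π.toHom g x))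
    (hno : π.HasNoInvariantVectors) {S : Finset G} (hS : S.Nonempty)
    (hai : π.HasAlmostInvariantVectors S) :
    ∃ (_ : MeasurableSpace π.closureRange) (_ : MulAction G π.closureRange)
      (ν : Measure π.closureRange), IsErgodicAction G ν ∧
        ¬ IsExpandingInMeasure (genSet (S : Set G)) ν := by
  have := π.compactSpace_closureRange htb
  have := π.secondCountableTopology_closureRange
  have : SecondCountableTopology H := UniformSpace.secondCountable_of_separable H
  let _ : MeasurableSpace π.closureRange := borel _
  have : BorelSpace π.closureRange := ⟨rfl⟩
  let _ := π.translationAction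
  have hact : ∀ (g : G) (k : π.closureRange), g • k = π.toClosureRange g * k := fun _ _ => rfl
  set ν : Measure π.closureRange := Measure.haarMeasure ⊤ with hν
  have hprob : IsProbabilityMeasure ν :=
    ⟨Measure.haarMeasure_self (K₀ := (⊤ : TopologicalSpace.PositiveCompacts _))⟩
  have hEA := isErgodicAction_translation ν hact
  refine ⟨inferInstance, inferInstance, ν, hEA, ?_⟩
  have := hEA.measurableConstSMul
  have := hEA.ergodicSMul
  rintro ⟨α, hα, hexp⟩
  have hn : (0 : ℝ) < S.card := by exact_mod_cast hS.card_pos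
  obtain ⟨v, hv0, hv⟩ := hai (α / (4 * S.card)) (by positivity)
  have hvpos : 0 < ‖v‖ := norm_pos_iff.2 hv0
  -- A single coefficient `k ↦ ⟪v, k w⟫` may be too small, so coefficients are summed over an
  -- orthonormal family nearly spanning the orbit of `v`. The error `‖v‖ / 2` leaves `3 / 4 * ‖v‖ ^
  -- 2`.
  obtain ⟨n, w, hw, happrox⟩ := exists_orthonormal_approx (htb v).closure (half_pos hvpos)
  have hcw : ∀ x : H, Continuous fun k : π.closureRange => (k : H ≃ₗᵢ[ℝ] H) x := fun x =>
    (continuous_orthogonal_apply x).comp continuous_subtype_val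
  have hint : ∀ x : H, Integrable (fun k : π.closureRange => (k : H ≃ₗᵢ[ℝ] H) x) ν := fun x =>
    (integrable_const ‖x‖).mono' (hcw x).aestronglyMeasurable
      (.of_forall fun k => (LinearIsometryEquiv.norm_map _ _).le)
  -- By invariance of Haar measure the average of an orbit is an invariant vector.
  have hmeanvec : ∀ x : H, ∫ k : π.closureRange, (k : H ≃ₗᵢ[ℝ] H) x ∂ν = 0 := by
    intro x
    refine hno _ fun g => ?_
    have h1 := (π.toHom g).toContinuousLinearEquiv.toContinuousLinearMap.integral_comp_comm (hint x)
    refine h1.symm.trans ?_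
    exact integral_mul_left_eq_self (μ := ν)
      (fun k : π.closureRange => (k : H ≃ₗᵢ[ℝ] H) x) (π.toClosureRange g)
  have hsq : ∀ (y x : H), Integrable (fun k : π.closureRange => ⟪y, (k : H ≃ₗᵢ[ℝ] H) x⟫ ^ 2) ν := by
    intro y x
    refine (integrable_const ((‖y‖ * ‖x‖) ^ 2)).mono'
      (((continuous_const.inner (hcw x)).pow 2).aestronglyMeasurable) (.of_forall fun k => ?_)
    rw [norm_pow]
    refine pow_le_pow_left₀ (norm_nonneg _) ((norm_inner_le_norm _ _).trans ?_) 2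
    rw [LinearIsometryEquiv.norm_map]
  have hone : ∀ i, α ^ 2 * ∫ k : π.closureRange, ⟪v, (k : H ≃ₗᵢ[ℝ] H) (w i)⟫ ^ 2 ∂ν ≤
      4 * S.card * ∑ s ∈ S, ∫ k : π.closureRange,
        ⟪π.toHom s v - v, (k : H ≃ₗᵢ[ℝ] H) (w i)⟫ ^ 2 ∂ν := by
    intro i
    have hcf : Continuous fun k : π.closureRange => ⟪v, (k : H ≃ₗᵢ[ℝ] H) (w i)⟫ :=
      continuous_const.inner (hcw (w i))
    have hL : MemLp (fun k : π.closureRange => ⟪v, (k : H ≃ₗᵢ[ℝ] H) (w i)⟫) 2 ν :=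
      MemLp.of_bound hcf.aestronglyMeasurable (‖v‖ * ‖w i‖) (.of_forall fun k => by
        refine (norm_inner_le_norm _ _).trans ?_
        rw [LinearIsometryEquiv.norm_map])
    have h0 : ∫ k : π.closureRange, ⟪v, (k : H ≃ₗᵢ[ℝ] H) (w i)⟫ ∂ν = 0 := by
      rw [integral_inner (hint _), hmeanvec, inner_zero_right]
    have key := hexp.sq_mul_integral_sq_le hS hα hcf.measurable hL h0
    refine key.trans (le_of_eq ?_)
    congr 1
    refine Finset.sum_congr rfl fun s _ => integral_congr_ae (.of_forall fun k => ?_)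
    have e : ⟪v, ((s⁻¹ • k : π.closureRange) : H ≃ₗᵢ[ℝ] H) (w i)⟫
        = ⟪π.toHom s v, (k : H ≃ₗᵢ[ℝ] H) (w i)⟫ := by
      rw [inner_apply_left]
      rfl
    simp only [e, inner_sub_left]
  have hswap : ∀ (y : H) (k : π.closureRange) (i : Fin n),
      ⟪y, (k : H ≃ₗᵢ[ℝ] H) (w i)⟫ ^ 2 = ⟪w i, (k : H ≃ₗᵢ[ℝ] H)⁻¹ y⟫ ^ 2 := by
    intro y k i
    rw [← ((k : H ≃ₗᵢ[ℝ] H)).inner_map_map (w i), orthogonal_apply_inv_apply, real_inner_comm]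
  have hlower : ∀ k : π.closureRange, 3 / 4 * ‖v‖ ^ 2
      ≤ ∑ i, ⟪v, (k : H ≃ₗᵢ[ℝ] H) (w i)⟫ ^ 2 := by
    intro k
    simp_rw [hswap]
    have hmem : (k : H ≃ₗᵢ[ℝ] H)⁻¹ v ∈ closure (Set.range fun g => π.toHom g v) := by
      refine map_mem_closure (f := fun U : H ≃ₗᵢ[ℝ] H => U v) (continuous_orthogonal_apply v)
        (π.closureRange.inv_mem k.2 : _ ∈ closure (π.toHom.range : Set (H ≃ₗᵢ[ℝ] H))) ?_
      rintro _ ⟨g, rfl⟩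
      exact ⟨g, rfl⟩
    have := happrox _ hmem
    rw [LinearIsometryEquiv.norm_map] at this
    refine le_trans (le_of_eq ?_) this
    ring
  -- Bessel's inequality makes this bound independent of the number `n` of coefficients.
  have hupper : ∀ s ∈ S, ∑ i, ∫ k : π.closureRange,
      ⟪π.toHom s v - v, (k : H ≃ₗᵢ[ℝ] H) (w i)⟫ ^ 2 ∂ν ≤ (α / (4 * S.card) * ‖v‖) ^ 2 := by
    intro s hs
    rw [← integral_finsetSum _ fun i _ => hsq _ _]
    have : ∀ k : π.closureRange, ∑ i, ⟪π.toHom s v - v, (k : H ≃ₗᵢ[ℝ] H) (w i)⟫ ^ 2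
        ≤ (α / (4 * S.card) * ‖v‖) ^ 2 := by
      intro k
      simp_rw [hswap]
      have hb := hw.sum_inner_products_le ((k : H ≃ₗᵢ[ℝ] H)⁻¹ (π.toHom s v - v))
        (s := Finset.univ)
      simp only [Real.norm_eq_abs, sq_abs, LinearIsometryEquiv.norm_map] at hb
      exact hb.trans (pow_le_pow_left₀ (norm_nonneg _) (hv s hs) 2)
    refine (integral_mono (integrable_finsetSum _ fun i _ => hsq _ _) (integrable_const _)
      this).trans ?_
    simp
  have hA : 3 / 4 * ‖v‖ ^ 2 ≤ ∑ i, ∫ k : π.closureRange,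
      ⟪v, (k : H ≃ₗᵢ[ℝ] H) (w i)⟫ ^ 2 ∂ν := by
    rw [← integral_finsetSum _ fun i _ => hsq _ _]
    refine le_trans ?_ (integral_mono (integrable_const (3 / 4 * ‖v‖ ^ 2))
      (integrable_finsetSum _ fun i _ => hsq _ _) hlower)
    simp
  have hsum := Finset.sum_le_sum fun i (_ : i ∈ Finset.univ) => hone i
  rw [← Finset.mul_sum, ← Finset.mul_sum, Finset.sum_comm] at hsum
  have h3 := Finset.sum_le_card_nsmul S _ _ hupper
  rw [nsmul_eq_mul] at h3
  have h4 := hsum.trans (mul_le_mul_of_nonneg_left h3 (by positivity))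
  have h5 := (mul_le_mul_of_nonneg_left hA (sq_nonneg α)).trans h4
  have e : 4 * (S.card : ℝ) * (S.card * (α / (4 * S.card) * ‖v‖) ^ 2) = α ^ 2 * ‖v‖ ^ 2 / 4 := by
    field_simp
  rw [e] at h5
  have : 0 < α ^ 2 * ‖v‖ ^ 2 := by positivity
  linarith

end OrthogonalRep

/-! ### Kazhdan pairs make ergodic actions expanding. -/

section KazhdanToExpansion

variable {G : Type u} [Group G] {X : Type v} [MeasurableSpace X] [MulAction G X]
  [MeasurableConstSMul G X] (ν : Measure X)

theorem integral_koopman [SMulInvariantMeasure G X ν] (g : G) (f : Lp ℂ 2 ν) :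
    ∫ x, koopman ν g f x ∂ν = ∫ x, f x ∂ν := by
  rw [integral_congr_ae (koopman_ae_eq ν g f)]
  exact (measurePreserving_smul g⁻¹ ν).integral_comp (measurableEmbedding_const_smul g⁻¹) f

theorem norm_toLp_two_sq {f : X → ℂ} (hf : MemLp f 2 ν) : ‖hf.toLp‖ ^ 2 = ∫ x, ‖f x‖ ^ 2 ∂ν := by
  have h1 := L2.inner_def (𝕜 := ℂ) hf.toLp hf.toLp
  rw [inner_self_eq_norm_sq_to_K] at h1
  have h2 : ∫ x, inner ℂ ((MemLp.toLp f hf : Lp ℂ 2 ν) x) ((MemLp.toLp f hf : Lp ℂ 2 ν) x) ∂ν = ∫ x, ((‖f x‖ ^ 2 : ℝ) : ℂ) ∂ν := by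
    refine integral_congr_ae ?_
    filter_upwards [hf.coeFn_toLp] with x hx
    rw [hx, inner_self_eq_norm_sq_to_K]
    norm_cast
  rw [h2, integral_complex_ofReal] at h1
  exact Complex.ofReal_injective ((Complex.ofReal_pow _ _).trans h1)

variable [IsProbabilityMeasure ν]

/-- An `L²`-function of mean zero which is invariant under an ergodic action vanishes. -/
theorem eq_zero_of_koopman_eq_self [ErgodicSMul G X ν] (f : Lp ℂ 2 ν)
    (hf : ∀ g : G, koopman ν g f = f) (h0 : ∫ x, f x ∂ν = 0) : f = 0 := by
  have hm : Measurable f := (Lp.stronglyMeasurable f).measurable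
  obtain ⟨c, hc⟩ : ∃ c : ℂ, f =ᵐ[ν] Function.const X c := by
    refine Filter.exists_eventuallyEq_const_of_forall_separating MeasurableSet fun U hU => ?_
    refine Filter.eventuallyConst_set.1 (aeconst_of_forall_preimage_smul_ae_eq G
      (hm hU).nullMeasurableSet fun g => ?_)
    have h1 := koopman_ae_eq ν g⁻¹ f
    rw [hf, inv_inv] at h1
    refine (h1.mono fun x hx => ?_ : ∀ᵐ x ∂ν, (x ∈ (g • ·) ⁻¹' (f ⁻¹' U)) = (x ∈ f ⁻¹' U))
    simp only [Set.mem_preimage, hx]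
  have hc0 : c = 0 := by
    rw [integral_congr_ae hc] at h0
    simpa using h0
  refine Lp.ext (hc.trans ?_)
  rw [hc0]
  exact (Lp.coeFn_zero ℂ 2 ν).symm

/-- The Koopman representation on the `L²`-functions of mean zero. -/
noncomputable def koopmanMeanZero [TopologicalSpace G] (hν : IsErgodicAction G ν) :
    ContUnitaryRep G (ℂ ∙ Lp.const 2 ν (1 : ℂ))ᗮ :=
  have := hν.ergodicSMul
  have hmem : ∀ (g : G), ∀ f ∈ (ℂ ∙ Lp.const 2 ν (1 : ℂ))ᗮ,
      koopman ν g f ∈ (ℂ ∙ Lp.const 2 ν (1 : ℂ))ᗮ := fun g f hf => by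
    rw [Submodule.mem_orthogonal_singleton_iff_inner_right, inner_const_one] at hf ⊢
    rw [integral_koopman, hf]
  { toHom := unitaryHomOfIsometries
      (fun g =>
        { toLinearMap := (koopman ν g).toLinearMap.restrict (hmem g)
          norm_map' := fun f => (koopman ν g).norm_map f })
      (fun f => Subtype.ext (koopman_one ν f.1)) (fun g h f => Subtype.ext (koopman_mul ν g h f.1))
    continuous_orbit := fun f => (hν.continuous_koopman f).subtype_mk _ }

theorem koopmanMeanZero_hasNoInvariantVectors [TopologicalSpace G] (hν : IsErgodicAction G ν) :
    (koopmanMeanZero ν hν).HasNoInvariantVectors := by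
  have := hν.ergodicSMul
  intro f hf
  refine Subtype.ext (eq_zero_of_koopman_eq_self ν f.1 (fun g => congrArg Subtype.val (hf g)) ?_)
  rw [← inner_const_one]
  exact Submodule.mem_orthogonal_singleton_iff_inner_right.1 f.2

end KazhdanToExpansion

/-- A Kazhdan pair `(S, ε)` with `1 ∈ S` makes every ergodic action `ε² / 4`-expanding. -/
theorem IsKazhdanPair.isExpandingWith {G : Type u} [Group G] [TopologicalSpace G] {S : Set G}
    {ε : ℝ} (hK : IsKazhdanPair.{u, v} S ε) (h1 : 1 ∈ S) {X : Type v} [MeasurableSpace X]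
    [MulAction G X] {ν : Measure X} (hν : IsErgodicAction G ν) :
    IsExpandingWith (genSet S) ν (ε ^ 2 / 4) := by
  have := hν.isProbabilityMeasure
  have := hν.measurableConstSMul
  have := hν.ergodicSMul
  intro A hA _ hAhalf
  set p : ℝ := ν.real A with hp
  have hp0 : 0 ≤ p := measureReal_nonneg
  have hp2 : p ≤ 1 / 2 := by
    have := ENNReal.toReal_mono (by simp) hAhalf
    simpa [hp, measureReal_def] using this
  have hfA : MemLp (A.indicator fun _ => (1 : ℂ)) 2 ν :=
    memLp_indicator_const 2 hA 1 (Or.inr (measure_ne_top _ _))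
  have hf : MemLp (fun x => A.indicator (fun _ => (1 : ℂ)) x - (p : ℂ)) 2 ν :=
    hfA.sub (memLp_const _)
  have hnorm : ‖hf.toLp‖ ^ 2 = p * (1 - p) := by
    rw [norm_toLp_two_sq]
    have e : ∀ x, ‖A.indicator (fun _ => (1 : ℂ)) x - (p : ℂ)‖ ^ 2
        = A.indicator (fun _ => 1 - 2 * p) x + p ^ 2 := by
      intro x
      by_cases hx : x ∈ A
      · simp only [Set.indicator_of_mem hx]
        rw [← Complex.ofReal_one, ← Complex.ofReal_sub, Complex.norm_real, Real.norm_eq_abs,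
          sq_abs]
        ring
      · simp [Set.indicator_of_notMem hx]
    simp_rw [e]
    rw [integral_add ((integrable_const _).indicator hA) (integrable_const _),
      integral_indicator_const _ hA]
    simp only [integral_const, smul_eq_mul, probReal_univ, ← hp]
    ring
  have hmem : hf.toLp ∈ (ℂ ∙ Lp.const 2 ν (1 : ℂ))ᗮ := by
    rw [Submodule.mem_orthogonal_singleton_iff_inner_right, inner_const_one,
      integral_congr_ae hf.coeFn_toLp, integral_sub (hfA.integrable (by norm_num))
      (integrable_const _), integral_indicator_const _ hA]
    simp [← hp]
  -- For a null set the test vector is zero and the Kazhdan property says nothing.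
  rcases hp0.eq_or_lt with hp00 | hp0'
  · have : ν A = 0 := (measureReal_eq_zero_iff).1 hp00.symm
    simp [this]
  have hne : (⟨hf.toLp, hmem⟩ : (ℂ ∙ Lp.const 2 ν (1 : ℂ))ᗮ) ≠ 0 := by
    intro h0
    have h0' : hf.toLp = 0 := congrArg Subtype.val h0
    rw [h0', norm_zero] at hnorm
    nlinarith
  have hnot := mt (hK.2.2 _ (koopmanMeanZero ν hν) (koopmanMeanZero_hasNoInvariantVectors ν hν)
    ⟨hf.toLp, hmem⟩) hne
  unfold ContUnitaryRep.IsAlmostInvariantVector at hnot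
  push Not at hnot
  obtain ⟨s, hs, hlt⟩ := hnot
  change ε * ‖hf.toLp‖ < ‖koopman ν s hf.toLp - hf.toLp‖ at hlt
  have hsA : MeasurableSet (s • A) := hA.const_smul s
  have hdiff : ‖koopman ν s hf.toLp - hf.toLp‖ ^ 2 = 2 * ν.real ((s • A) \ A) := by
    rw [koopman_toLp, ← MemLp.toLp_sub, norm_toLp_two_sq]
    have e : ∀ x, ‖(((fun x => A.indicator (fun _ => (1 : ℂ)) x - (p : ℂ)) ∘ (s⁻¹ • ·))
          - (fun x => A.indicator (fun _ => (1 : ℂ)) x - (p : ℂ))) x‖ ^ 2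
        = (s • A \ A).indicator (fun _ => (1 : ℝ)) x
          + (A \ s • A).indicator (fun _ => (1 : ℝ)) x := by
      intro x
      have hiff : s⁻¹ • x ∈ A ↔ x ∈ s • A := Set.mem_smul_set_iff_inv_smul_mem.symm
      rw [Pi.sub_apply, Function.comp_apply, sub_sub_sub_cancel_right]
      by_cases hx : x ∈ A <;> by_cases hx' : x ∈ s • A <;>
        simp [Set.indicator, hx, hx', hiff]
    simp_rw [e]
    rw [integral_add ((integrable_const _).indicator (hsA.diff hA))
      ((integrable_const _).indicator (hA.diff hsA)), integral_indicator_const _ (hsA.diff hA),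
      integral_indicator_const _ (hA.diff hsA)]
    have h2 : ν.real (s • A) = ν.real A := by
      rw [measureReal_def, measureReal_def, measure_smul]
    have h3 := measureReal_sdiff_add_inter (μ := ν) (s := s • A) hA
    have h4 := measureReal_sdiff_add_inter (μ := ν) (s := A) hsA
    rw [Set.inter_comm] at h4
    simp only [smul_eq_mul, mul_one]
    linarith
  have hε : 0 < ε := hK.2.1
  have h5 : ε ^ 2 * (p * (1 - p)) < 2 * ν.real ((s • A) \ A) := by
    rw [← hnorm, ← hdiff, ← mul_pow]
    exact pow_lt_pow_left₀ hlt (by positivity) two_ne_zero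
  -- Here `p ≤ 1 / 2` enters, as `1 - p ≥ 1 / 2`; together with the factor 2 of `hdiff` it yields
  -- the constant `ε ^ 2 / 4`.
  have h6 : (1 + ε ^ 2 / 4) * p ≤ ν.real A + ν.real (s • A \ A) := by
    have : ε ^ 2 * (p * (1 / 2)) ≤ ε ^ 2 * (p * (1 - p)) := by gcongr; linarith
    rw [← hp]
    linarith
  have hsub : A ∪ (s • A \ A) ⊆ genSet S • A := by
    rintro x (hx | ⟨hx, -⟩)
    · exact ⟨1, h1, x, hx, one_smul _ _⟩
    · obtain ⟨y, hy, rfl⟩ := hx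
      exact ⟨⟨s, Subgroup.subset_closure hs⟩, hs, y, hy, rfl⟩
  refine le_trans ?_ (measure_mono hsub)
  rw [measure_union Set.disjoint_sdiff_right (hsA.diff hA), ← ofReal_measureReal (μ := ν) (s := A),
    ← ofReal_measureReal (μ := ν) (s := s • A \ A), ← ENNReal.ofReal_mul (by positivity),
    ← ENNReal.ofReal_add measureReal_nonneg measureReal_nonneg]
  exact ENNReal.ofReal_le_ofReal h6

/-- A unitary representation is an orthogonal representation of the underlying real Hilbert
space. -/
theorem ContUnitaryRep.exists_orthogonalRep {G : Type u} [Group G] [TopologicalSpace G]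
    {H : Type v} [NormedAddCommGroup H] [InnerProductSpace ℂ H] (π : ContUnitaryRep G H) :
    ∃ (_ : InnerProductSpace ℝ H) (ρ : OrthogonalRep G H), ∀ g x, ρ.toHom g x = π.toHom g x := by
  let _ : InnerProductSpace ℝ H := InnerProductSpace.rclikeToReal ℂ H
  let f : G → H →ₗᵢ[ℝ] H := fun g =>
    { toFun := π.toHom g
      map_add' := map_add (π.toHom g)
      map_smul' := fun c x => map_smul (π.toHom g) (c : ℂ) x
      norm_map' := (π.toHom g).norm_map }
  refine ⟨inferInstance, ⟨unitaryHomOfIsometries f (fun x => ?_) (fun g h x => ?_),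
    π.continuous_orbit⟩, fun g x => rfl⟩
  · change π.toHom 1 x = x
    rw [map_one]; rfl
  · change π.toHom (g * h) x = π.toHom g (π.toHom h x)
    rw [map_mul]; rfl

/-! ### Hilbert sums, splittings and the non-expanding action. -/

namespace OrthogonalRep

section DirectSum

variable {G : Type u} [Group G] [TopologicalSpace G] {H : ℕ → Type v}
  [∀ n, NormedAddCommGroup (H n)] [∀ n, InnerProductSpace ℝ (H n)]

/-- The action of a group element on a Hilbert sum of representations. -/
noncomputable def directSumIsometry (π : ∀ n, OrthogonalRep G (H n)) (g : G) :
    lp H 2 →ₗᵢ[ℝ] lp H 2 where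
  toFun f := ⟨fun n => (π n).toHom g (f n), by
    refine (memℓp_gen_iff (by norm_num)).2 ?_
    simpa using (memℓp_gen_iff (p := 2) (by norm_num)).1 (lp.memℓp f)⟩
  map_add' f h := lp.ext (funext fun n => map_add ((π n).toHom g) (f n) (h n))
  map_smul' c f := lp.ext (funext fun n => map_smul ((π n).toHom g) c (f n))
  norm_map' f := by
    rw [lp.norm_eq_tsum_rpow (by norm_num), lp.norm_eq_tsum_rpow (by norm_num)]
    simp

theorem directSumIsometry_apply (π : ∀ n, OrthogonalRep G (H n)) (g : G) (f : lp H 2) (n : ℕ) :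
    directSumIsometry π g f n = (π n).toHom g (f n) := rfl

theorem directSumIsometry_single (π : ∀ n, OrthogonalRep G (H n)) (g : G) (n : ℕ) (x : H n) :
    directSumIsometry π g (lp.single 2 n x) = lp.single 2 n ((π n).toHom g x) := by
  refine lp.ext (funext fun m => ?_)
  rw [directSumIsometry_apply]
  rcases eq_or_ne m n with rfl | h
  · rw [lp.single_apply_self, lp.single_apply_self]
  · rw [lp.single_apply_ne _ _ _ h, lp.single_apply_ne _ _ _ h, map_zero]

theorem topologicalClosure_span_single :
    (Submodule.span ℝ (Set.range fun p : Σ n, H n => lp.single 2 p.1 p.2)).topologicalClosure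
      = (⊤ : Submodule ℝ (lp H 2)) := by
  refine Submodule.eq_top_iff'.2 fun f => ?_
  refine mem_closure_of_tendsto (lp.hasSum_single (by norm_num) f) (.of_forall fun s => ?_)
  exact Submodule.sum_mem _ fun n _ => Submodule.subset_span ⟨⟨n, f n⟩, rfl⟩

/-- The Hilbert sum of a sequence of representations. -/
noncomputable def directSum (π : ∀ n, OrthogonalRep G (H n)) : OrthogonalRep G (lp H 2) where
  toHom := unitaryHomOfIsometries (directSumIsometry π)
    (fun f => lp.ext (funext fun n => (π n).one_apply (f n)))
    (fun g h f => lp.ext (funext fun n => (π n).mul_apply g h (f n)))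
  continuous_orbit := continuous_isometry_apply_of_total (directSumIsometry π)
    topologicalClosure_span_single (by
      rintro _ ⟨⟨n, x⟩, rfl⟩
      simp_rw [directSumIsometry_single]
      exact (lp.isometry_single n).continuous.comp ((π n).continuous_orbit x))

theorem HasNoInvariantVectors.directSum {π : ∀ n, OrthogonalRep G (H n)}
    (h : ∀ n, (π n).HasNoInvariantVectors) : (directSum π).HasNoInvariantVectors := fun f hf =>
  lp.ext (funext fun n => h n (f n) fun g => congrArg (fun f : lp H 2 => f n) (hf g))

theorem HasAlmostInvariantVectors.directSum {π : ∀ n, OrthogonalRep G (H n)} {S : Set G}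
    {v : ∀ n, H n} (hv : ∀ n, v n ≠ 0)
    (h : ∀ n : ℕ, ∀ g ∈ S, ‖(π n).toHom g (v n) - v n‖ ≤ 1 / ((n : ℝ) + 1) * ‖v n‖) :
    (directSum π).HasAlmostInvariantVectors S := by
  intro ε hε
  obtain ⟨n, hn⟩ := exists_nat_one_div_lt hε
  refine ⟨lp.single 2 n (v n), fun h0 => hv n ?_, fun g hg => ?_⟩
  · rw [← norm_eq_zero, ← lp.norm_single (p := 2) (by norm_num), h0, norm_zero]
  · change ‖directSumIsometry π g (lp.single 2 n (v n)) - lp.single 2 n (v n)‖ ≤ _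
    rw [directSumIsometry_single, ← lp.single_sub, lp.norm_single (by norm_num),
      lp.norm_single (by norm_num)]
    exact (h n g hg).trans (by gcongr)

end DirectSum

variable {G : Type u} [Group G] [TopologicalSpace G]
  {H : Type v} [NormedAddCommGroup H] [InnerProductSpace ℝ H]

/-- If a representation has almost invariant vectors, then so does one of the summands of an
orthogonal decomposition. -/
theorem HasAlmostInvariantVectors.restrict_or_orthogonal {π : OrthogonalRep G H} {S : Set G}
    (h : π.HasAlmostInvariantVectors S) (N : Submodule ℝ H) [N.HasOrthogonalProjection]
    (hN : ∀ g, ∀ x ∈ N, π.toHom g x ∈ N) :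
    (π.restrict N hN).HasAlmostInvariantVectors S ∨
      (π.restrict Nᗮ (π.apply_mem_orthogonal hN)).HasAlmostInvariantVectors S := by
  by_contra! hcon
  simp only [HasAlmostInvariantVectors, not_forall, not_exists, not_and, not_le] at hcon
  obtain ⟨⟨a, ha, hna⟩, ⟨b, hb, hnb⟩⟩ := hcon
  have hm : 0 < min a b := lt_min ha hb
  -- If both summands fail, with constants `a` and `b`, halving the tolerance forces each component
  -- to carry at most a quarter of `‖x‖ ^ 2`, which is impossible for `x ≠ 0`.
  obtain ⟨x, hx, hxS⟩ := h (min a b / 2) (by positivity)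
  obtain ⟨y, hy, z, hz, rfl⟩ := N.exists_add_mem_mem_orthogonal x
  have hxpos : 0 < ‖y + z‖ := norm_pos_iff.2 hx
  have horth : ∀ p ∈ N, ∀ q ∈ Nᗮ, ‖p + q‖ ^ 2 = ‖p‖ ^ 2 + ‖q‖ ^ 2 := by
    intro p hp q hq
    have := norm_add_sq_eq_norm_sq_add_norm_sq_real (N.inner_right_of_mem_orthogonal hp hq)
    linarith
  have hbound : ∀ g ∈ S, ‖π.toHom g y - y‖ ^ 2 + ‖π.toHom g z - z‖ ^ 2
      ≤ (min a b / 2) ^ 2 * (‖y‖ ^ 2 + ‖z‖ ^ 2) := by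
    intro g hg
    rw [← horth _ (N.sub_mem (hN g y hy) hy) _
      (Nᗮ.sub_mem (π.apply_mem_orthogonal hN g z hz) hz), ← horth y hy z hz, ← mul_pow]
    refine pow_le_pow_left₀ (norm_nonneg _) (le_trans (le_of_eq ?_) (hxS g hg)) 2
    rw [map_add]
    congr 1
    abel
  have hya : ‖y‖ ^ 2 ≤ (‖y‖ ^ 2 + ‖z‖ ^ 2) / 4 := by
    by_cases hy0 : y = 0
    · rw [hy0, norm_zero, zero_pow two_ne_zero]; positivity
    obtain ⟨g, hg, hlt⟩ := hna ⟨y, hy⟩ (fun h => hy0 (congrArg Subtype.val h))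
    change a * ‖y‖ < ‖π.toHom g y - y‖ at hlt
    have h1 : (min a b * ‖y‖) ^ 2 ≤ ‖π.toHom g y - y‖ ^ 2 := by
      exact pow_le_pow_left₀ (mul_nonneg hm.le (norm_nonneg _))
        ((mul_le_mul_of_nonneg_right (min_le_left a b) (norm_nonneg y)).trans hlt.le) 2
    have h2 := h1.trans ((le_add_of_nonneg_right (sq_nonneg ‖π.toHom g z - z‖)).trans
      (hbound g hg))
    have h3 : min a b ^ 2 * ‖y‖ ^ 2 ≤ min a b ^ 2 * ((‖y‖ ^ 2 + ‖z‖ ^ 2) / 4) := by linarith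
    exact le_of_mul_le_mul_left h3 (by positivity)
  have hzb : ‖z‖ ^ 2 ≤ (‖y‖ ^ 2 + ‖z‖ ^ 2) / 4 := by
    by_cases hz0 : z = 0
    · rw [hz0, norm_zero, zero_pow two_ne_zero]; positivity
    obtain ⟨g, hg, hlt⟩ := hnb ⟨z, hz⟩ (fun h => hz0 (congrArg Subtype.val h))
    change b * ‖z‖ < ‖π.toHom g z - z‖ at hlt
    have h1 : (min a b * ‖z‖) ^ 2 ≤ ‖π.toHom g z - z‖ ^ 2 := by
      exact pow_le_pow_left₀ (mul_nonneg hm.le (norm_nonneg _))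
        ((mul_le_mul_of_nonneg_right (min_le_right a b) (norm_nonneg z)).trans hlt.le) 2
    have h2 := h1.trans ((le_add_of_nonneg_left (sq_nonneg ‖π.toHom g y - y‖)).trans
      (hbound g hg))
    have h3 : min a b ^ 2 * ‖z‖ ^ 2 ≤ min a b ^ 2 * ((‖y‖ ^ 2 + ‖z‖ ^ 2) / 4) := by linarith
    exact le_of_mul_le_mul_left h3 (by positivity)
  have := horth y hy z hz
  nlinarith

theorem totallyBounded_range_restrict (π : OrthogonalRep G H) (N : Submodule ℝ H)
    (hN : ∀ g, ∀ x ∈ N, π.toHom g x ∈ N) (x : N) :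
    TotallyBounded (Set.range fun g => (π.restrict N hN).toHom g x) ↔
      TotallyBounded (Set.range fun g => π.toHom g (x : H)) := by
  rw [← totallyBounded_image_iff (isUniformEmbedding_subtype_val (p := (· ∈ N))).isUniformInducing,
    ← Set.range_comp]
  rfl

/-- If all orbits of `π` are relatively compact and `π` has almost invariant vectors, then it has an
invariant separable closed subspace with almost invariant vectors. -/
theorem HasAlmostInvariantVectors.exists_separable [SecondCountableTopology G]
    {π : OrthogonalRep G H} {S : Set G} (h : π.HasAlmostInvariantVectors S) :
    ∃ (N : Submodule ℝ H) (hN : ∀ g, ∀ x ∈ N, π.toHom g x ∈ N), IsClosed (N : Set H) ∧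
      TopologicalSpace.SeparableSpace N ∧ (π.restrict N hN).HasAlmostInvariantVectors S := by
  choose v hv0 hv using fun n : ℕ => h (1 / ((n : ℝ) + 1)) (by positivity)
  -- The orbits of countably many witnesses suffice; each is separable as a continuous image of the
  -- second countable `G`.
  set D : Set H := ⋃ n, Set.range fun g => π.toHom g (v n) with hD
  have hDsep : TopologicalSpace.IsSeparable D :=
    .iUnion fun n => TopologicalSpace.isSeparable_range (π.continuous_orbit (v n))
  have hspan : ∀ g, ∀ x ∈ Submodule.span ℝ D, π.toHom g x ∈ Submodule.span ℝ D := by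
    intro g x hx
    induction hx using Submodule.span_induction with
    | mem x hx =>
      obtain ⟨n, k, rfl⟩ := Set.mem_iUnion.1 hx
      exact Submodule.subset_span (Set.mem_iUnion.2 ⟨n, g * k, π.mul_apply g k (v n)⟩)
    | zero => rw [map_zero]; exact Submodule.zero_mem _
    | add x y _ _ hx hy => rw [map_add]; exact Submodule.add_mem _ hx hy
    | smul c x _ hx => rw [map_smul]; exact Submodule.smul_mem _ c hx
  have hN : ∀ g, ∀ x ∈ (Submodule.span ℝ D).topologicalClosure,
      π.toHom g x ∈ (Submodule.span ℝ D).topologicalClosure := fun g x hx =>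
    map_mem_closure (π.toHom g).continuous hx (hspan g)
  refine ⟨_, hN, Submodule.isClosed_topologicalClosure _,
    (hDsep.span (R := ℝ)).closure.separableSpace, fun ε hε => ?_⟩
  obtain ⟨n, hn⟩ := exists_nat_one_div_lt hε
  have hmem : v n ∈ (Submodule.span ℝ D).topologicalClosure :=
    subset_closure (Submodule.subset_span (Set.mem_iUnion.2 ⟨n, 1, π.one_apply (v n)⟩))
  refine ⟨⟨v n, hmem⟩, fun h0 => hv0 n (congrArg Subtype.val h0), fun g hg => ?_⟩
  exact (hv n g hg).trans (mul_le_mul_of_nonneg_right hn.le (norm_nonneg _))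

/-- A representation with almost invariant vectors but no invariant ones gives rise to an ergodic
action which is not expanding in measure. -/
theorem exists_nonexpanding [CompleteSpace H] [SecondCountableTopology G] (π : OrthogonalRep G H)
    (hno : π.HasNoInvariantVectors) {S : Finset G} (hS : S.Nonempty)
    (hai : π.HasAlmostInvariantVectors S) :
    ∃ (X : Type v) (_ : MeasurableSpace X) (_ : MulAction G X) (ν : Measure X),
      IsErgodicAction G ν ∧ ¬ IsExpandingInMeasure (genSet (S : Set G)) ν := by
  have : CompleteSpace π.compactVectors := π.isClosed_compactVectors.completeSpace_coe
  rcases hai.restrict_or_orthogonal π.compactVectors π.apply_mem_compactVectors with h | h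
  · obtain ⟨N, hN, hNc, hNs, hNai⟩ := h.exists_separable
    have : CompleteSpace N := hNc.completeSpace_coe
    obtain ⟨m, act, ν, h1, h2⟩ := exists_nonexpanding_of_totallyBounded _
      (fun x => (totallyBounded_range_restrict _ N hN x).2
        ((totallyBounded_range_restrict _ _ _ _).2 x.1.2))
      ((hno.restrict _ _).restrict N hN) hS hNai
    exact ⟨_, m, act, ν, h1, h2⟩
  · obtain ⟨act, ν, h1, h2⟩ := exists_nonexpanding_of_mixing _
      -- A vector of the complement with totally bounded orbit is a compact vector, hence orthogonal
      -- to itself.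
      (fun F ε hε => exists_abs_inner_lt _ (fun x hx => by
        have hx' := (totallyBounded_range_restrict _ _ _ x).1 hx
        refine Subtype.ext (inner_self_eq_zero (𝕜 := ℝ).1 ?_)
        exact Submodule.inner_right_of_mem_orthogonal
          (K := π.compactVectors) ((mem_compactVectors π).2 hx') x.2) F hε) hS h
    exact ⟨_, _, act, ν, h1, h2⟩

end OrthogonalRep

/-! ### Conclusion. -/

/-- If `S` is compact but not a Kazhdan set, then there is an orthogonal representation with almost
invariant vectors but no invariant ones. -/
theorem exists_orthogonalRep_of_not_isKazhdanSet {G : Type u} [Group G] [TopologicalSpace G]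
    {S : Set G} (hc : IsCompact S) (hS : ¬ IsKazhdanSet.{u, v} S) :
    ∃ (H : Type v) (_ : NormedAddCommGroup H) (_ : InnerProductSpace ℝ H) (_ : CompleteSpace H)
      (π : OrthogonalRep G H), π.HasNoInvariantVectors ∧ π.HasAlmostInvariantVectors S := by
  simp only [IsKazhdanSet, IsKazhdanPair, ContUnitaryRep.IsKazhdanPairFor, not_exists, not_and,
    not_forall] at hS
  -- One counterexample for each tolerance `1 / (n + 1)`; their Hilbert sum serves all tolerances at
  -- once.
  choose H i₁ i₂ i₃ π hno v hv hv0 using fun n : ℕ =>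
    hS (1 / ((n : ℝ) + 1)) hc (by positivity)
  choose j ρ hρ using fun n => (π n).exists_orthogonalRep
  refine ⟨lp H 2, inferInstance, inferInstance, inferInstance, OrthogonalRep.directSum ρ,
    .directSum fun n x hx => hno n x fun g => (hρ n g x).symm.trans (hx g),
    .directSum hv0 fun n g hg => ?_⟩
  rw [hρ]
  exact hv n g hg

theorem mainTheorem10 :
    (∀ (G : Type u) [Group G] [TopologicalSpace G] [IsTopologicalGroup G]
        [LocallyCompactSpace G] [SecondCountableTopology G] [T2Space G]
        (S : Set G), S.Finite → S⁻¹ = S → 1 ∈ S →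
        (IsKazhdanSet.{u, v} S ↔
          ∀ (X : Type v) [MeasurableSpace X] [MulAction G X] (ν : Measure X),
            IsErgodicAction G ν → IsExpandingInMeasure (genSet S) ν)) ∧
    (∀ ε : ℝ, 0 < ε → ∃ α : ℝ, 0 < α ∧
      ∀ (G : Type u) [Group G] [TopologicalSpace G] [IsTopologicalGroup G]
        [LocallyCompactSpace G] [SecondCountableTopology G] [T2Space G]
        (S : Set G), S.Finite → S⁻¹ = S → 1 ∈ S → IsKazhdanPair.{u, v} S ε →
        ∀ (X : Type v) [MeasurableSpace X] [MulAction G X] (ν : Measure X),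
          IsErgodicAction G ν → IsExpandingWith (genSet S) ν α) := by
  refine ⟨fun G _ _ _ _ _ _ S hS _ h1 => ⟨?_, fun hexp => ?_⟩, fun ε hε =>
    ⟨ε ^ 2 / 4, by positivity, fun G _ _ _ _ _ _ S _ _ h1 hK X _ _ ν hν =>
      hK.isExpandingWith h1 hν⟩⟩
  · rintro ⟨ε, hK⟩ X _ _ ν hν
    have := hK.2.1
    exact ⟨ε ^ 2 / 4, by positivity, hK.isExpandingWith h1 hν⟩
  · by_contra hnot
    lift S to Finset G using hS
    obtain ⟨H, _, _, _, π, hno, hai⟩ :=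
      exists_orthogonalRep_of_not_isKazhdanSet S.finite_toSet.isCompact hnot
    obtain ⟨X, _, _, ν, hν, hne⟩ := π.exists_nonexpanding hno ⟨1, h1⟩ hai
    exact hne (hexp X ν hν)
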